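/- Let $k$ be a commutative ring; algebras are associative unital $k$-algebras, and bimodules are $k$-central (the two induced $k$-actions agree). A Morita context $(R,S,P,Q,\varphi,\psi)$ consists of $k$-algebras $R,S$, an $(S,R)$-bimodule $P$, an $(R,S)$-bimodule $Q$, and bimodule isomorphisms $\varphi\colon P\otimes_R Q\to S$ and $\psi\colon Q\otimes_S P\to R$ with $\varphi(p\otimes q)\,p'=p\,\psi(q\otimes p')$ and $\psi(q\otimes p)\,q'=q\,\varphi(p\otimes q')$ for all $p,p'\in P$, $q,q'\in Q$. A morphism of Morita contexts $(R,S,P,Q,\varphi,\psi)\to(R',S',P',Q',\varphi',\psi')$ consists of $k$-algebra morphisms $R\to R'$, $S\to S'$ and $k$-linear maps $P\to P'$, $Q\to Q'$ that are compatible with the module structures and with $\varphi,\varphi'$ and $\psi,\psi'$. For an $(R,R)$-bimodule $M$ let $H_\bullet(R,M)$ be the Hochschild homology, i.e. the homology of the complex $C_n(R,M)=M\otimes_k R^{\otimes_k n}$ with $$b(m\otimes r_1\otimes\dots\otimes r_n)=mr_1\otimes r_2\otimes\dots\otimes r_n+\sum_{i=1}^{n-1}(-1)^i\, m\otimes\dots\otimes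 r_ir_{i+1}\otimes\dots\otimes r_n+(-1)^n\, r_nm\otimes r_1\otimes\dots\otimes r_{n-1}.$$ Let $HC_\bullet(R)$ be the cyclic homology, i.e. the homology of the total complex of the cyclic bicomplex, which has $C_q(R,R)$ in bidegree $(p,q)$, $p,q\ge 0$, vertical differential $b$ in even and $-b'$ in odd columns (where $b'$ is $b$ without its last summand), and horizontal differential $1-t$ from odd to even columns and $N=1+t+\dots+t^q$ from even columns $p\ge2$ to odd columns, where $t(r_0\otimes\dots\otimes r_q)=(-1)^q\,r_q\otimes r_0\otimes\dots\otimes r_{q-1}$. Then for every Morita context $(R,S,P,Q,\varphi,\psi)$, every $(R,R)$-bimodule $M$ and every $n\ge 0$ there is an isomorphism of $k$-modules $$H_n(R,M)\cong H_n(S,\,P\otimes_R M\otimes_R Q),$$ natural in $M$ and in the Morita context; that is, for every morphism of Morita contexts as above, every $(R',R')$-bimodule $M'$ and every $k$-linear map $M\to M'$ compatible with the bimodule structures along $R\to R'$, these isomorphisms commute with the induced maps. For $M=R$ one has, for every $n\ge0$, isomorphisms of $k$-modules $$HC_n(R)\cong HC_n(S),$$ natural in the Morita context. -/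

import Mathlib

open CategoryTheory TensorProduct MulOpposite

universe u v

namespace MoritaInvariance

noncomputable section

/-! ### Bimodules and their tensor products over a noncommutative algebra -/

/-- An `(A, B)`-bimodule over the commutative ground ring `k`: a left `A`-module and right
`B`-module (i.e. left `Bᵐᵒᵖ`-module) with commuting actions, on which `k` acts centrally, through
either of the two actions. -/
structure Bimodule (k : Type v) [CommRing k] (A B : Type u) [Ring A] [Ring B] [Algebra k A]
    [Algebra k B] where
  carrier : Type u
  [addCommGroup : AddCommGroup carrier]
  [module : Module k carrier]
  [left : Module A carrier]
  [right : Module Bᵐᵒᵖ carrier]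
  [leftTower : IsScalarTower k A carrier]
  [rightTower : IsScalarTower k Bᵐᵒᵖ carrier]
  [comm : SMulCommClass A Bᵐᵒᵖ carrier]

namespace Bimodule

variable {k : Type v} [CommRing k]
  {A B C A' B' C' : Type u} [Ring A] [Ring B] [Ring C] [Ring A'] [Ring B'] [Ring C']
  [Algebra k A] [Algebra k B] [Algebra k C] [Algebra k A'] [Algebra k B'] [Algebra k C']

instance : CoeSort (Bimodule k A B) (Type u) := ⟨Bimodule.carrier⟩

attribute [instance] addCommGroup module left right leftTower rightTower comm

variable (k A) in
/-- The algebra `A` as an `(A, A)`-bimodule. -/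
abbrev self : Bimodule k A A where
  carrier := A

/-- A morphism of bimodules over a pair of algebra morphisms `f : A → A'`, `g : B → B'`. For
identity morphisms `f` and `g` this is a morphism of `(A, B)`-bimodules. -/
structure HomOver (f : A →ₐ[k] A') (g : B →ₐ[k] B') (X : Bimodule k A B)
    (Y : Bimodule k A' B') where
  toLinearMap : X →ₗ[k] Y
  map_smul : ∀ (a : A) (x : X), toLinearMap (a • x) = f a • toLinearMap x
  map_op_smul : ∀ (b : B) (x : X), toLinearMap (op b • x) = op (g b) • toLinearMap x

/-- An algebra morphism `f` as a morphism of bimodules over `(f, f)`. -/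
def HomOver.ofAlgHom (f : A →ₐ[k] A') : HomOver f f (self k A) (self k A') where
  toLinearMap := f.toLinearMap
  map_smul a x := _root_.map_mul f (a : A) (x : A)
  map_op_smul b x := _root_.map_mul f (x : A) (b : A)

/-- An isomorphism of `(A, B)`-bimodules. -/
structure BimodEquiv (X Y : Bimodule k A B) where
  toLinearEquiv : X ≃ₗ[k] Y
  map_smul : ∀ (a : A) (x : X), toLinearEquiv (a • x) = a • toLinearEquiv x
  map_op_smul : ∀ (b : B) (x : X), toLinearEquiv (op b • x) = op b • toLinearEquiv x

section Tensor

variable (X : Bimodule k A B) (Y : Bimodule k B C)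

/-- The submodule of `X ⊗[k] Y` spanned by all `x b ⊗ y - x ⊗ b y`. -/
def balancing : Submodule k (X ⊗[k] Y) :=
  Submodule.span k {z | ∃ (x : X) (b : B) (y : Y), z = (op b • x) ⊗ₜ[k] y - x ⊗ₜ[k] (b • y)}

/-- The tensor product `X ⊗_B Y`. -/
abbrev TensorCarrier : Type u := (X ⊗[k] Y) ⧸ balancing X Y

/-- Left multiplication by `a` on `X ⊗_B Y`. -/
def tensorLeft (a : A) : TensorCarrier X Y →ₗ[k] TensorCarrier X Y :=
  (balancing X Y).mapQ (balancing X Y) (TensorProduct.map (Algebra.lsmul k k X a) LinearMap.id) <| by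
    rw [balancing, Submodule.span_le]
    rintro _ ⟨x, b, y, rfl⟩
    refine Submodule.subset_span ⟨a • x, b, y, ?_⟩
    simp [smul_comm a (op b) x]

/-- Right multiplication by `c` on `X ⊗_B Y`. -/
def tensorRight (c : Cᵐᵒᵖ) : TensorCarrier X Y →ₗ[k] TensorCarrier X Y :=
  (balancing X Y).mapQ (balancing X Y) (TensorProduct.map LinearMap.id (Algebra.lsmul k k Y c)) <| by
    rw [balancing, Submodule.span_le]
    rintro _ ⟨x, b, y, rfl⟩
    refine Submodule.subset_span ⟨x, b, c • y, ?_⟩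
    simp [smul_comm b c y]

variable {X Y} in
theorem tensor_hom_ext {Z : Type*} [AddCommGroup Z] [Module k Z] {f g : TensorCarrier X Y →ₗ[k] Z}
    (h : ∀ (x : X) (y : Y), f (Submodule.Quotient.mk (x ⊗ₜ[k] y)) =
      g (Submodule.Quotient.mk (x ⊗ₜ[k] y))) : f = g :=
  Submodule.linearMap_qext _ (TensorProduct.ext' h)

/-- The left action of `A` on `X ⊗_B Y`. -/
def tensorLeftHom : A →+* Module.End k (TensorCarrier X Y) where
  toFun := tensorLeft X Y
  map_one' := tensor_hom_ext fun x y => by simp [tensorLeft]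
  map_mul' a b := tensor_hom_ext fun x y => by simp [tensorLeft]
  map_zero' := tensor_hom_ext fun x y => by simp [tensorLeft]
  map_add' a b := tensor_hom_ext fun x y => by simp [tensorLeft, TensorProduct.add_tmul]

/-- The right action of `C` on `X ⊗_B Y`. -/
def tensorRightHom : Cᵐᵒᵖ →+* Module.End k (TensorCarrier X Y) where
  toFun := tensorRight X Y
  map_one' := tensor_hom_ext fun x y => by simp [tensorRight]
  map_mul' a b := tensor_hom_ext fun x y => by simp [tensorRight]
  map_zero' := tensor_hom_ext fun x y => by simp [tensorRight]
  map_add' a b := tensor_hom_ext fun x y => by simp [tensorRight, TensorProduct.tmul_add]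

/-- The `(A, C)`-bimodule `X ⊗_B Y`, with `a (x ⊗ y) c = a x ⊗ y c`. -/
def tensor : Bimodule k A C where
  carrier := TensorCarrier X Y
  left := Module.compHom (TensorCarrier X Y) (tensorLeftHom X Y)
  right := Module.compHom (TensorCarrier X Y) (tensorRightHom X Y)
  leftTower :=
    letI := Module.compHom (TensorCarrier X Y) (tensorLeftHom X Y)
    ⟨fun r a z => LinearMap.congr_fun (f := tensorLeft X Y (r • a)) (g := r • tensorLeft X Y a)
      (tensor_hom_ext fun x y => by
        simp [tensorLeft, ← TensorProduct.smul_tmul']) z⟩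
  rightTower :=
    letI := Module.compHom (TensorCarrier X Y) (tensorRightHom X Y)
    ⟨fun r c z => LinearMap.congr_fun (f := tensorRight X Y (r • c)) (g := r • tensorRight X Y c)
      (tensor_hom_ext fun x y => by simp [tensorRight]) z⟩
  comm :=
    letI := Module.compHom (TensorCarrier X Y) (tensorLeftHom X Y)
    letI := Module.compHom (TensorCarrier X Y) (tensorRightHom X Y)
    ⟨fun a c z => LinearMap.congr_fun (f := tensorLeft X Y a ∘ₗ tensorRight X Y c)
      (g := tensorRight X Y c ∘ₗ tensorLeft X Y a)
      (tensor_hom_ext fun x y => by simp [tensorLeft, tensorRight]) z⟩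

variable {X Y}

/-- The pure tensor `x ⊗_B y`. -/
def tmul (x : X) (y : Y) : X.tensor Y :=
  (Submodule.Quotient.mk (x ⊗ₜ[k] y) : TensorCarrier X Y)

theorem smul_tmul_left (a : A) (x : X) (y : Y) : a • tmul x y = tmul (a • x) y := rfl

theorem op_smul_tmul (c : C) (x : X) (y : Y) : op c • tmul x y = tmul x (op c • y) := rfl

theorem tmul_balanced (x : X) (b : B) (y : Y) : tmul (op b • x) y = tmul x (b • y) :=
  (Submodule.Quotient.eq _).2 (Submodule.subset_span ⟨x, b, y, rfl⟩)

/-- The morphism `μ ⊗ ν : X ⊗_B Y → X' ⊗_{B'} Y'`, `x ⊗ y ↦ μ x ⊗ ν y`. -/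
def HomOver.tensor {f : A →ₐ[k] A'} {g : B →ₐ[k] B'} {h : C →ₐ[k] C'}
    {X' : Bimodule k A' B'} {Y' : Bimodule k B' C'} (μ : HomOver f g X X') (ν : HomOver g h Y Y') :
    HomOver f h (X.tensor Y) (X'.tensor Y') :=
  let F : TensorCarrier X Y →ₗ[k] TensorCarrier X' Y' :=
    (balancing X Y).mapQ (balancing X' Y')
      (TensorProduct.map μ.toLinearMap ν.toLinearMap) <| by
        rw [balancing, Submodule.span_le]
        rintro _ ⟨x, b, y, rfl⟩
        refine Submodule.subset_span ⟨μ.toLinearMap x, g b, ν.toLinearMap y, ?_⟩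
        simp [μ.map_op_smul, ν.map_smul]
  { toLinearMap := F
    map_smul := fun a z => LinearMap.congr_fun (f := F ∘ₗ tensorLeft X Y a)
      (g := tensorLeft X' Y' (f a) ∘ₗ F)
      (tensor_hom_ext fun x y => by simp [F, tensorLeft, μ.map_smul]) z
    map_op_smul := fun c z => LinearMap.congr_fun (f := F ∘ₗ tensorRight X Y (op c))
      (g := tensorRight X' Y' (op (h c)) ∘ₗ F)
      (tensor_hom_ext fun x y => by simp [F, tensorRight, ν.map_op_smul]) z }

end Tensor

end Bimodule

/-! ### Morita contexts -/

/-- A Morita context `(R, S, P, Q, φ, ψ)`: two `k`-algebras, bimodules `P` over `(S, R)` and `Q`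
over `(R, S)`, and bimodule isomorphisms `φ : P ⊗_R Q ≃ S` and `ψ : Q ⊗_S P ≃ R` such that
`φ (p ⊗ q) p' = p ψ (q ⊗ p')` and `ψ (q ⊗ p) q' = q φ (p ⊗ q')`. -/
structure MoritaContext (k : Type v) [CommRing k] where
  R : Type u
  S : Type u
  [ringR : Ring R]
  [ringS : Ring S]
  [algebraR : Algebra k R]
  [algebraS : Algebra k S]
  P : Bimodule k S R
  Q : Bimodule k R S
  φ : Bimodule.BimodEquiv (P.tensor Q) (Bimodule.self k S)
  ψ : Bimodule.BimodEquiv (Q.tensor P) (Bimodule.self k R)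
  φ_smul : ∀ (p : P) (q : Q) (p' : P),
    (φ.toLinearEquiv (Bimodule.tmul p q) : S) • p' =
      op (ψ.toLinearEquiv (Bimodule.tmul q p') : R) • p
  ψ_smul : ∀ (q : Q) (p : P) (q' : Q),
    (ψ.toLinearEquiv (Bimodule.tmul q p) : R) • q' =
      op (φ.toLinearEquiv (Bimodule.tmul p q') : S) • q

namespace MoritaContext

variable {k : Type v} [CommRing k]

attribute [instance] ringR ringS algebraR algebraS

/-- A morphism of Morita contexts: algebra morphisms `R → R'`, `S → S'` and compatible morphisms
of bimodules `P → P'`, `Q → Q'` that commute with the pairings. -/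
structure Hom (𝓒 𝓓 : MoritaContext.{u} k) where
  onR : 𝓒.R →ₐ[k] 𝓓.R
  onS : 𝓒.S →ₐ[k] 𝓓.S
  onP : Bimodule.HomOver onS onR 𝓒.P 𝓓.P
  onQ : Bimodule.HomOver onR onS 𝓒.Q 𝓓.Q
  map_φ : ∀ z, 𝓓.φ.toLinearEquiv ((onP.tensor onQ).toLinearMap z) = onS (𝓒.φ.toLinearEquiv z)
  map_ψ : ∀ z, 𝓓.ψ.toLinearEquiv ((onQ.tensor onP).toLinearMap z) = onR (𝓒.ψ.toLinearEquiv z)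

/-- The `(S, S)`-bimodule `P ⊗_R M ⊗_R Q`. -/
def baseChange (𝓒 : MoritaContext.{u} k) (M : Bimodule k 𝓒.R 𝓒.R) : Bimodule k 𝓒.S 𝓒.S :=
  (𝓒.P.tensor M).tensor 𝓒.Q

/-- The morphism `P ⊗_R M ⊗_R Q → P' ⊗_{R'} M' ⊗_{R'} Q'` induced by a morphism of Morita contexts
and a morphism of bimodules `M → M'` over it. -/
def Hom.baseChange {𝓒 𝓓 : MoritaContext.{u} k} (F : Hom 𝓒 𝓓) {M : Bimodule k 𝓒.R 𝓒.R}
    {N : Bimodule k 𝓓.R 𝓓.R} (μ : Bimodule.HomOver F.onR F.onR M N) :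
    Bimodule.HomOver F.onS F.onS (𝓒.baseChange M) (𝓓.baseChange N) :=
  (F.onP.tensor μ).tensor F.onQ

end MoritaContext

/-! ### Hochschild chains -/

section Chains

variable (k : Type v) [CommRing k] (R M : Type u) [Ring R] [Algebra k R] [AddCommGroup M]
  [Module k M]

/-- The module of Hochschild chains `C_n(R, M) = M ⊗ R ⊗ ⋯ ⊗ R` with `n` factors `R`, all tensor
products being over `k`. -/
def Chains (n : ℕ) : Type (max u v) := M ⊗[k] (⨂[k] (_ : Fin n), R)

instance (n : ℕ) : AddCommGroup (Chains k R M n) :=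
  inferInstanceAs (AddCommGroup (M ⊗[k] (⨂[k] (_ : Fin n), R)))

instance (n : ℕ) : Module k (Chains k R M n) :=
  inferInstanceAs (Module k (M ⊗[k] (⨂[k] (_ : Fin n), R)))

variable {R M}

/-- The pure tensor `m ⊗ r₁ ⊗ ⋯ ⊗ rₙ`. -/
def pureTensor {n : ℕ} (x : M × (Fin n → R)) : Chains k R M n :=
  (x.1 ⊗ₜ[k] PiTensorProduct.tprod k x.2 : M ⊗[k] (⨂[k] (_ : Fin n), R))

section

variable {n : ℕ}

theorem pureTensor_add (m m' : M) (r : Fin n → R) :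
    pureTensor k (m + m', r) = pureTensor k (m, r) + pureTensor k (m', r) :=
  TensorProduct.add_tmul _ _ _

theorem pureTensor_smul (c : k) (m : M) (r : Fin n → R) : pureTensor k (c • m, r) = c • pureTensor k (m, r) :=
  rfl

theorem pureTensor_update_add (m : M) (r : Fin n → R) (i : Fin n) (a a' : R) :
    pureTensor k (m, Function.update r i (a + a')) =
      pureTensor k (m, Function.update r i a) + pureTensor k (m, Function.update r i a') := by
  simp only [pureTensor, MultilinearMap.map_update_add]
  exact TensorProduct.tmul_add _ _ _

theorem pureTensor_update_smul (m : M) (r : Fin n → R) (i : Fin n) (c : k) (a : R) :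
    pureTensor k (m, Function.update r i (c • a)) = c • pureTensor k (m, Function.update r i a) := by
  simp only [pureTensor, MultilinearMap.map_update_smul]
  exact TensorProduct.tmul_smul _ _ _

variable {k} {Z : Type*} [AddCommGroup Z] [Module k Z]

theorem chains_hom_ext {f g : Chains k R M n →ₗ[k] Z} (h : ∀ x, f (pureTensor k x) = g (pureTensor k x)) :
    f = g := by
  refine TensorProduct.ext (P₂ := Z) (M := M) (N := ⨂[k] (_ : Fin n), R) ?_
  refine LinearMap.ext fun m => PiTensorProduct.ext (MultilinearMap.ext fun r => ?_)
  exact h (m, r)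

/-- The linear map on chains with the given values on pure tensors. -/
def chainsLift (F : M →ₗ[k] MultilinearMap k (fun _ : Fin n => R) Z) : Chains k R M n →ₗ[k] Z :=
  TensorProduct.lift ((PiTensorProduct.lift (R := k) (s := fun _ : Fin n => R)
    (E := Z)).toLinearMap ∘ₗ F)

theorem chainsLift_pureTensor (F : M →ₗ[k] MultilinearMap k (fun _ : Fin n => R) Z)
    (x : M × (Fin n → R)) : chainsLift F (pureTensor k x) = F x.1 x.2 := by
  refine (TensorProduct.lift.tmul _ _).trans ?_
  simp

end

/-- The map on chains induced by an algebra morphism and a linear map of coefficients,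
`m ⊗ r₁ ⊗ ⋯ ⊗ rₙ ↦ μ m ⊗ f r₁ ⊗ ⋯ ⊗ f rₙ`. -/
def chainsMap {R' M' : Type u} [Ring R'] [Algebra k R'] [AddCommGroup M'] [Module k M']
    (f : R →ₐ[k] R') (μ : M →ₗ[k] M') (n : ℕ) : Chains k R M n →ₗ[k] Chains k R' M' n :=
  TensorProduct.map (M := M) (M₂ := M') μ (PiTensorProduct.map fun _ => f.toLinearMap)

theorem chainsMap_pureTensor {R' M' : Type u} [Ring R'] [Algebra k R'] [AddCommGroup M'] [Module k M']
    (f : R →ₐ[k] R') (μ : M →ₗ[k] M') (n : ℕ) (x : M × (Fin n → R)) :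
    chainsMap k f μ n (pureTensor k x) = pureTensor k (μ x.1, fun i => f (x.2 i)) := by
  refine (TensorProduct.map_tmul μ (PiTensorProduct.map fun _ => f.toLinearMap) x.1
    (PiTensorProduct.tprod k x.2)).trans ?_
  simp [pureTensor, PiTensorProduct.map_tprod]

variable [Module R M] [Module Rᵐᵒᵖ M]

/-- The `i`-th face of the tuple `(m, r₁, …, rₙ₊₁)`: it is `(m r₁, r₂, …, rₙ₊₁)` for `i = 0`,
`(m, r₁, …, rᵢ rᵢ₊₁, …, rₙ₊₁)` for `0 < i < n + 1` and `(rₙ₊₁ m, r₁, …, rₙ)` for `i = n + 1`. -/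
def faceTuple {n : ℕ} (i : Fin (n + 2)) (x : M × (Fin (n + 1) → R)) : M × (Fin n → R) :=
  (if (i : ℕ) = 0 then op (x.2 0) • x.1
    else if (i : ℕ) = n + 1 then x.2 (Fin.last n) • x.1
    else x.1,
    fun j =>
      if (j : ℕ) + 1 < i then x.2 j.castSucc
      else if (j : ℕ) + 1 = i then x.2 j.castSucc * x.2 j.succ
      else x.2 j.succ)

theorem faceTuple_faceTuple [SMulCommClass R Rᵐᵒᵖ M] {n : ℕ} (i j : Fin (n + 2)) (h : i ≤ j)
    (x : M × (Fin (n + 2) → R)) :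
    faceTuple i (faceTuple j.succ x) = faceTuple j (faceTuple i.castSucc x) := by
  obtain ⟨i, hi⟩ := i
  obtain ⟨j, hj⟩ := j
  obtain ⟨m, r⟩ := x
  simp only [Fin.mk_le_mk] at h
  refine Prod.ext ?_ (funext fun a => ?_)
  · rcases Nat.eq_zero_or_pos i with rfl | h0
    · rcases Nat.eq_zero_or_pos j with rfl | h1
      · simp [faceTuple, mul_smul]
      · by_cases hl : j = n + 1
        · subst hl
          simp [faceTuple, smul_comm]
        · have : ¬ j = 0 := by omega
          simp [faceTuple, hl, this, h1]
    · have h1 : ¬ j = 0 := by omega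
      have h2 : ¬ i = 0 := by omega
      by_cases hl : j = n + 1
      · subst hl
        by_cases hk : i = n + 1
        · subst hk
          simp [faceTuple, mul_smul]
        · have : ¬ i = n + 2 := by omega
          have : ¬ n + 1 < i := by omega
          simp [faceTuple, *]
          grind
      · have : ¬ i = n + 2 := by omega
        have : ¬ i = n + 1 := by omega
        simp [faceTuple, *]
  · obtain ⟨a, ha⟩ := a
    simp only [faceTuple, Fin.castSucc_mk, Fin.succ_mk]
    split_ifs <;> first | rfl | omega | simp [mul_assoc]

variable [IsScalarTower k R M] [IsScalarTower k Rᵐᵒᵖ M]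

theorem faceTuple_update {n : ℕ} (i : Fin (n + 2)) (m : M) (r : Fin (n + 1) → R)
    (a : Fin (n + 1)) :
    (∃ L : R →ₗ[k] M, ∀ c, faceTuple i (m, Function.update r a c) =
      (L c, (faceTuple i (m, r)).2)) ∨
    (∃ (s : Fin n) (L : R →ₗ[k] R), ∀ c, faceTuple i (m, Function.update r a c) =
      ((faceTuple i (m, r)).1, Function.update (faceTuple i (m, r)).2 s (L c))) := by
  obtain ⟨i, hi⟩ := i
  obtain ⟨a, ha⟩ := a
  by_cases h : a < i
  · by_cases hn : a < n
    · have h' : a + 1 ≤ i := h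
      refine Or.inr ⟨⟨a, hn⟩, if a + 1 = i then LinearMap.mulRight k (r ⟨a + 1, by omega⟩)
        else LinearMap.id, fun c => Prod.ext ?_ (funext fun j => ?_)⟩
      · simp only [faceTuple, Function.update_apply, Fin.ext_iff, Fin.val_last, Fin.val_zero]
        split_ifs <;> first | rfl | omega
      · obtain ⟨j, hj⟩ := j
        simp only [faceTuple, Function.update_apply, Fin.ext_iff, Fin.castSucc_mk, Fin.succ_mk]
        split_ifs <;> first | rfl | omega | (subst_vars; rfl)
    · refine Or.inl ⟨(LinearMap.toSpanSingleton R M m).restrictScalars k, fun c => Prod.ext ?_ (funext fun j => ?_)⟩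
      · simp only [faceTuple, Function.update_apply, Fin.ext_iff, Fin.val_last, Fin.val_zero]
        split_ifs <;> first | rfl | omega
      · obtain ⟨j, hj⟩ := j
        simp only [faceTuple, Function.update_apply, Fin.ext_iff, Fin.castSucc_mk, Fin.succ_mk]
        split_ifs <;> first | rfl | omega
  · by_cases h0 : a = 0
    · refine Or.inl ⟨(LinearMap.toSpanSingleton Rᵐᵒᵖ M m).restrictScalars k ∘ₗ
        (opLinearEquiv k).toLinearMap, fun c => Prod.ext ?_ (funext fun j => ?_)⟩
      · simp only [faceTuple, Function.update_apply, Fin.ext_iff, Fin.val_last, Fin.val_zero]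
        split_ifs <;> first | rfl | omega
      · obtain ⟨j, hj⟩ := j
        simp only [faceTuple, Function.update_apply, Fin.ext_iff, Fin.castSucc_mk, Fin.succ_mk]
        split_ifs <;> first | rfl | omega
    · obtain ⟨a, rfl⟩ := Nat.exists_eq_succ_of_ne_zero h0
      refine Or.inr ⟨⟨a, by omega⟩, if a + 1 = i then LinearMap.mulLeft k (r ⟨a, by omega⟩)
        else LinearMap.id, fun c => Prod.ext ?_ (funext fun j => ?_)⟩
      · simp only [faceTuple, Function.update_apply, Fin.ext_iff, Fin.val_last, Fin.val_zero]
        split_ifs <;> first | rfl | contradiction | omega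
      · obtain ⟨j, hj⟩ := j
        simp only [faceTuple, Function.update_apply, Fin.ext_iff, Fin.castSucc_mk, Fin.succ_mk]
        split_ifs <;> first | rfl | omega | (subst_vars; rfl)

/-- The face operator `d_i : C_{n+1}(R, M) → C_n(R, M)`. -/
def face {n : ℕ} (i : Fin (n + 2)) : Chains k R M (n + 1) →ₗ[k] Chains k R M n :=
  chainsLift
    { toFun := fun m =>
        MultilinearMap.mk' (fun r => pureTensor k (faceTuple i (m, r)))
          (fun r a c c' => by
            rcases faceTuple_update k i m r a with ⟨L, hL⟩ | ⟨s, L, hL⟩ <;>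
              simp [hL, pureTensor_add, pureTensor_update_add])
          (fun r a t c => by
            rcases faceTuple_update k i m r a with ⟨L, hL⟩ | ⟨s, L, hL⟩ <;>
              simp [hL, pureTensor_smul, pureTensor_update_smul])
      map_add' := fun m m' => by
        ext r
        simp only [MultilinearMap.mk'_apply, add_apply, faceTuple, ← pureTensor_add]
        split_ifs <;> simp
      map_smul' := fun t m => by
        ext r
        simp only [MultilinearMap.mk'_apply, smul_apply, faceTuple, RingHom.id_apply, ← pureTensor_smul]
        split_ifs
        · rw [smul_comm]
        · rw [smul_comm]
        · rfl }

theorem face_pureTensor {n : ℕ} (i : Fin (n + 2)) (x : M × (Fin (n + 1) → R)) :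
    face k i (pureTensor k x) = pureTensor k (faceTuple i x) :=
  chainsLift_pureTensor _ _

theorem face_comp_face [SMulCommClass R Rᵐᵒᵖ M] {n : ℕ} (i j : Fin (n + 2)) (h : i ≤ j) :
    face (R := R) (M := M) k i ∘ₗ face k j.succ = face k j ∘ₗ face k i.castSucc :=
  chains_hom_ext fun x => by simp [face_pureTensor, faceTuple_faceTuple i j h]

variable (R M) in
/-- The Hochschild boundary `b = ∑_{i = 0}^{n + 1} (-1)^i d_i`. -/
def hochschildBoundary (n : ℕ) : Chains k R M (n + 1) →ₗ[k] Chains k R M n :=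
  ∑ i : Fin (n + 2), (-1 : ℤ) ^ (i : ℕ) • face k i

variable (R M) in
/-- The operator `b' = ∑_{i = 0}^{n} (-1)^i d_i`, in which the last face is omitted. -/
def barBoundary (n : ℕ) : Chains k R M (n + 1) →ₗ[k] Chains k R M n :=
  ∑ i : Fin (n + 1), (-1 : ℤ) ^ (i : ℕ) • face k i.castSucc

section Sums

variable {k} {ι X Y Z : Type*} [AddCommGroup X] [AddCommGroup Y] [AddCommGroup Z] [Module k X]
  [Module k Y] [Module k Z]

theorem sum_comp (s : Finset ι) (f : ι → Y →ₗ[k] Z) (g : X →ₗ[k] Y) :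
    (∑ i ∈ s, f i) ∘ₗ g = ∑ i ∈ s, f i ∘ₗ g := by
  ext x
  simp

theorem comp_sum (s : Finset ι) (f : ι → X →ₗ[k] Y) (g : Y →ₗ[k] Z) :
    g ∘ₗ (∑ i ∈ s, f i) = ∑ i ∈ s, g ∘ₗ f i := by
  ext x
  simp

end Sums

theorem alternating_double_sum {Z : Type*} [AddCommGroup Z] {n : ℕ}
    (F : Fin (n + 1) → Fin (n + 2) → Z)
    (hF : ∀ i j : Fin (n + 1), i ≤ j → F i j.succ = F j i.castSucc) :
    ∑ i : Fin (n + 1), ∑ j : Fin (n + 2), ((-1 : ℤ) ^ (i : ℕ) * (-1) ^ (j : ℕ)) • F i j = 0 := by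
  simp only [← Finset.sum_product']
  refine Finset.sum_involution
    (fun x _ => if h : x.2 ≤ x.1.castSucc then
        (⟨x.2, lt_of_le_of_lt h x.1.2⟩, x.1.succ)
      else (x.2.pred (by rintro h'; simp [h'] at h), x.1.castSucc)) ?_ ?_ ?_ ?_
  · rintro ⟨i, j⟩ -
    by_cases h : j ≤ i.castSucc
    · have := hF ⟨j, lt_of_le_of_lt h i.2⟩ i h
      have e : (⟨j, lt_of_le_of_lt h i.2⟩ : Fin (n + 1)).castSucc = j := rfl
      simp only [h, dite_true, this, e, ← add_smul, Fin.val_succ]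
      rw [pow_succ]
      convert zero_smul ℤ (F i j) using 2
      ring
    · obtain rfl | ⟨j, rfl⟩ := Fin.eq_zero_or_eq_succ j
      · exact absurd (Fin.zero_le _) h
      have hij : i ≤ j := Fin.le_def.2 (Nat.lt_succ_iff.1 (Fin.lt_def.1 (not_le.1 h)))
      have := hF i j hij
      simp only [h, dite_false, this, Fin.pred_succ, ← add_smul, Fin.val_succ, Fin.val_castSucc]
      rw [pow_succ]
      convert zero_smul ℤ (F j i.castSucc) using 2
      ring
  · rintro ⟨i, j⟩ - - h
    by_cases h' : j ≤ i.castSucc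
    · have := congrArg (fun x => (x.2 : ℕ)) h
      simp only [h', dite_true, Fin.val_succ] at this
      have : (j : ℕ) ≤ i := h'
      omega
    · have := congrArg (fun x => (x.2 : ℕ)) h
      simp only [h', dite_false, Fin.val_castSucc] at this
      exact h' (Fin.le_def.2 this.ge)
  · simp
  · rintro ⟨i, j⟩ -
    by_cases h : j ≤ i.castSucc
    · have : ¬ i.succ ≤ j := by simp [Fin.le_def] at h ⊢; omega
      simp [h, Fin.ext_iff, Fin.le_def]
      simp [Fin.le_def] at h this
      grind
    · obtain rfl | ⟨j, rfl⟩ := Fin.eq_zero_or_eq_succ j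
      · exact absurd (Fin.zero_le _) h
      have hij : i ≤ j := Fin.le_def.2 (Nat.lt_succ_iff.1 (Fin.lt_def.1 (not_le.1 h)))
      simp [h, hij]

theorem hochschildBoundary_comp [SMulCommClass R Rᵐᵒᵖ M] (n : ℕ) :
    hochschildBoundary k R M n ∘ₗ hochschildBoundary k R M (n + 1) = 0 := by
  simp only [hochschildBoundary, sum_comp, comp_sum, LinearMap.smul_comp,
    LinearMap.comp_smul]
  rw [← alternating_double_sum (fun (i : Fin (n + 2)) (j : Fin (n + 3)) =>
    face (R := R) (M := M) k i ∘ₗ face k j) fun i j h => face_comp_face k i j h]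
  rw [Finset.sum_comm]
  simp [mul_comm, Finset.smul_sum, smul_smul]

theorem barBoundary_comp [SMulCommClass R Rᵐᵒᵖ M] (n : ℕ) :
    barBoundary k R M n ∘ₗ barBoundary k R M (n + 1) = 0 := by
  simp only [barBoundary, sum_comp, comp_sum, LinearMap.smul_comp,
    LinearMap.comp_smul]
  rw [← alternating_double_sum (fun (i : Fin (n + 1)) (j : Fin (n + 2)) =>
    face (R := R) (M := M) k i.castSucc ∘ₗ face k j.castSucc) fun i j h => by
      simpa using face_comp_face (R := R) (M := M) k i.castSucc j.castSucc (by simpa using h)]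
  rw [Finset.sum_comm]
  simp [mul_comm, Finset.smul_sum, smul_smul]

section Map

variable {R' M' : Type u} [Ring R'] [Algebra k R'] [AddCommGroup M'] [Module k M']
  [Module R' M'] [Module R'ᵐᵒᵖ M'] [IsScalarTower k R' M'] [IsScalarTower k R'ᵐᵒᵖ M']
  (f : R →ₐ[k] R') (μ : M →ₗ[k] M')

theorem face_comp_chainsMap (hl : ∀ (r : R) (m : M), μ (r • m) = f r • μ m)
    (hr : ∀ (r : R) (m : M), μ (op r • m) = op (f r) • μ m)
    {n : ℕ} (i : Fin (n + 2)) :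
    face k i ∘ₗ chainsMap k f μ (n + 1) = chainsMap k f μ n ∘ₗ face k i :=
  chains_hom_ext fun x => by
    simp only [LinearMap.comp_apply, face_pureTensor, chainsMap_pureTensor]
    congr 1
    refine Prod.ext ?_ (funext fun j => ?_) <;> simp only [faceTuple] <;> split_ifs <;> simp [hl, hr]

theorem hochschildBoundary_comp_chainsMap (hl : ∀ (r : R) (m : M), μ (r • m) = f r • μ m)
    (hr : ∀ (r : R) (m : M), μ (op r • m) = op (f r) • μ m)
    (n : ℕ) :
    hochschildBoundary k R' M' n ∘ₗ chainsMap k f μ (n + 1) =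
      chainsMap k f μ n ∘ₗ hochschildBoundary k R M n := by
  simp only [hochschildBoundary, sum_comp, comp_sum, LinearMap.smul_comp,
    LinearMap.comp_smul, face_comp_chainsMap k f μ hl hr]

theorem barBoundary_comp_chainsMap (hl : ∀ (r : R) (m : M), μ (r • m) = f r • μ m)
    (hr : ∀ (r : R) (m : M), μ (op r • m) = op (f r) • μ m)
    (n : ℕ) :
    barBoundary k R' M' n ∘ₗ chainsMap k f μ (n + 1) =
      chainsMap k f μ n ∘ₗ barBoundary k R M n := by
  simp only [barBoundary, sum_comp, comp_sum, LinearMap.smul_comp,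
    LinearMap.comp_smul, face_comp_chainsMap k f μ hl hr]

end Map

end Chains

/-! ### The cyclic operator and the cyclic bicomplex -/

section Cyclic

variable (k : Type v) [CommRing k] (R : Type u) [Ring R] [Algebra k R]

/-- The cyclic rotation `(r₀, r₁, …, rₙ) ↦ (rₙ, r₀, …, rₙ₋₁)`. -/
def rotTuple {R : Type u} : {n : ℕ} → R × (Fin n → R) → R × (Fin n → R)
  | 0, x => x
  | n + 1, x => (x.2 (Fin.last n), Fin.cons x.1 fun j => x.2 j.castSucc)

section

variable {R : Type u} {n : ℕ} (a : R) (r : Fin (n + 1) → R) (c : R)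

theorem rotTuple_update_last :
    rotTuple (a, Function.update r (Fin.last n) c) = (c, (rotTuple (a, r)).2) := by
  simp [rotTuple, Fin.castSucc_ne_last]

theorem rotTuple_update_castSucc (i : Fin n) :
    rotTuple (a, Function.update r i.castSucc c) =
      ((rotTuple (a, r)).1, Function.update (rotTuple (a, r)).2 i.succ c) := by
  refine Prod.ext ?_ (funext fun j => ?_)
  · simp [rotTuple, Function.update_apply, (Fin.castSucc_ne_last i).symm]
  · obtain rfl | ⟨j, rfl⟩ := Fin.eq_zero_or_eq_succ j
    · simp [rotTuple, Function.update_apply, (Fin.succ_ne_zero i).symm]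
    · simp [rotTuple, Function.update_apply]

end

/-- The operator `r₀ ⊗ r₁ ⊗ ⋯ ⊗ rₙ ↦ rₙ ⊗ r₀ ⊗ ⋯ ⊗ rₙ₋₁`. -/
def rot : (n : ℕ) → Chains k R R n →ₗ[k] Chains k R R n
  | 0 => LinearMap.id
  | n + 1 => chainsLift
    { toFun := fun a =>
        MultilinearMap.mk' (fun r => pureTensor k (rotTuple (a, r)))
          (fun r i c c' => by
            refine Fin.lastCases ?_ (fun i => ?_) i <;>
              simp [rotTuple_update_last, rotTuple_update_castSucc, pureTensor_add, pureTensor_update_add])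
          (fun r i t c => by
            refine Fin.lastCases ?_ (fun i => ?_) i <;>
              simp [rotTuple_update_last, rotTuple_update_castSucc, pureTensor_smul, pureTensor_update_smul])
      map_add' := fun a a' => by
        ext r
        simpa [rotTuple] using pureTensor_update_add k (r (Fin.last n))
          (Fin.cons 0 fun j => r j.castSucc : Fin (n + 1) → R) 0 a a'
      map_smul' := fun t a => by
        ext r
        simpa [rotTuple] using pureTensor_update_smul k (r (Fin.last n))
          (Fin.cons 0 fun j => r j.castSucc : Fin (n + 1) → R) 0 t a }

theorem rot_pureTensor {n : ℕ} (x : R × (Fin n → R)) : rot k R n (pureTensor k x) = pureTensor k (rotTuple x) := by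
  cases n
  · rfl
  · exact chainsLift_pureTensor _ _

/-- The cyclic operator `t_n`, with its sign: `r₀ ⊗ r₁ ⊗ ⋯ ⊗ rₙ ↦ (-1)^n rₙ ⊗ r₀ ⊗ ⋯ ⊗ rₙ₋₁`. -/
def cyclicOp (n : ℕ) : Module.End k (Chains k R R n) := (-1 : ℤ) ^ n • rot k R n

/-- The norm operator `N = 1 + t + ⋯ + t ^ n`. -/
def normOp (n : ℕ) : Module.End k (Chains k R R n) := ∑ j ∈ Finset.range (n + 1), cyclicOp k R n ^ j

theorem cons_rotTuple {R : Type u} {n : ℕ} (x : R × (Fin n → R)) (i : Fin (n + 1)) :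
    (Fin.cons (rotTuple x).1 (rotTuple x).2 : Fin (n + 1) → R) i =
      (Fin.cons x.1 x.2 : Fin (n + 1) → R) (i - 1) := by
  cases n with
  | zero =>
    have : i - 1 = i := Fin.ext (by omega)
    rw [this]
    rfl
  | succ n =>
    refine Fin.cases ?_ (fun j => ?_) i
    · have : (0 : Fin (n + 2)) - 1 = (Fin.last n).succ := by
        rw [sub_eq_iff_eq_add, Fin.succ_last, Fin.last_add_one]
      rw [this, Fin.cons_succ]
      rfl
    · have : j.succ - 1 = j.castSucc := by
        rw [sub_eq_iff_eq_add, Fin.coeSucc_eq_succ]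
      rw [this, Fin.cons_succ]
      refine Fin.cases rfl (fun l => ?_) j
      rw [← Fin.succ_castSucc]
      rfl

theorem cons_iterate_rotTuple {R : Type u} {n : ℕ} (x : R × (Fin n → R)) (j : ℕ)
    (i : Fin (n + 1)) :
    (Fin.cons (rotTuple^[j] x).1 (rotTuple^[j] x).2 : Fin (n + 1) → R) i =
      (Fin.cons x.1 x.2 : Fin (n + 1) → R) (i - j • (1 : Fin (n + 1))) := by
  induction j generalizing i with
  | zero => simp
  | succ j ih =>
    rw [Function.iterate_succ_apply', cons_rotTuple, ih]
    rw [succ_nsmul', sub_sub]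

theorem cyclicOp_pow (n : ℕ) : cyclicOp k R n ^ (n + 1) = 1 := by
  have h (j : ℕ) (x : R × (Fin n → R)) :
      (rot k R n ^ j) (pureTensor k x) = pureTensor k (rotTuple^[j] x) := by
    induction j with
    | zero => rfl
    | succ j ih =>
      rw [pow_succ', Module.End.mul_apply, ih, rot_pureTensor, Function.iterate_succ_apply']
  have h' : rot k R n ^ (n + 1) = 1 := chains_hom_ext fun x => by
    have hx : (Fin.cons (rotTuple^[n + 1] x).1 (rotTuple^[n + 1] x).2 : Fin (n + 1) → R) =
        Fin.cons x.1 x.2 := funext fun i => by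
      have : (n + 1) • (1 : Fin (n + 1)) = 0 := by
        simpa using card_nsmul_eq_zero (x := (1 : Fin (n + 1)))
      rw [cons_iterate_rotTuple, this, sub_zero]
    rw [h, Prod.ext (Fin.cons_inj.1 hx).1 (Fin.cons_inj.1 hx).2]
    rfl
  rw [cyclicOp, smul_pow, h', ← pow_mul, (Nat.even_mul_succ_self n).neg_one_pow, one_smul]

variable {R} in
theorem faceTuple_succ_rotTuple {n : ℕ} (i : Fin (n + 1)) (x : R × (Fin (n + 1) → R)) :
    faceTuple i.succ (rotTuple x) = rotTuple (faceTuple i.castSucc x) := by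
  obtain ⟨i, hi⟩ := i
  obtain ⟨m, r⟩ := x
  cases n with
  | zero =>
    obtain rfl : i = 0 := by omega
    refine Prod.ext ?_ (funext fun a => a.elim0)
    simp [faceTuple, rotTuple]
  | succ n =>
    refine Prod.ext ?_ (funext fun a => ?_)
    · simp only [faceTuple, rotTuple, Fin.val_succ, Fin.val_castSucc, Fin.val_last, Fin.succ_last]
      split_ifs <;> first | rfl | contradiction | omega
    · refine Fin.cases ?_ (fun a => ?_) a
      · simp [faceTuple, rotTuple]
        split_ifs <;> first | rfl | omega
      · obtain ⟨a, ha⟩ := a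
        simp only [faceTuple, rotTuple, Fin.val_succ, Fin.val_castSucc, Fin.cons_succ]
        split_ifs <;> first | rfl | omega

variable {R} in
theorem faceTuple_zero_rotTuple {n : ℕ} (x : R × (Fin (n + 1) → R)) :
    faceTuple 0 (rotTuple x) = faceTuple (Fin.last (n + 1)) x := by
  refine Prod.ext ?_ (funext fun a => ?_)
  · simp [faceTuple, rotTuple]
  · simp [faceTuple, rotTuple]

/-- The face operators with their signs. -/
def signedFace (n : ℕ) (i : Fin (n + 2)) : Chains k R R (n + 1) →ₗ[k] Chains k R R n :=
  (-1 : ℤ) ^ (i : ℕ) • face k i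

theorem signedFace_succ (n : ℕ) (i : Fin (n + 1)) :
    signedFace k R n i.succ ∘ₗ cyclicOp k R (n + 1) =
      cyclicOp k R n ∘ₗ signedFace k R n i.castSucc := by
  have : face k i.succ ∘ₗ rot k R (n + 1) = rot k R n ∘ₗ face k i.castSucc :=
    chains_hom_ext fun x => by simp [face_pureTensor, rot_pureTensor, faceTuple_succ_rotTuple]
  simp only [signedFace, cyclicOp, LinearMap.smul_comp, LinearMap.comp_smul, smul_smul, this]
  congr 1
  simp only [Fin.val_succ, Fin.val_castSucc]
  ring

theorem signedFace_zero (n : ℕ) :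
    signedFace k R n 0 ∘ₗ cyclicOp k R (n + 1) = signedFace k R n (Fin.last (n + 1)) := by
  have : face k 0 ∘ₗ rot k R (n + 1) = face k (Fin.last (n + 1)) :=
    chains_hom_ext fun x => by simp [face_pureTensor, rot_pureTensor, faceTuple_zero_rotTuple]
  rw [signedFace, signedFace, cyclicOp, LinearMap.comp_smul, LinearMap.smul_comp, this]
  simp

theorem hochschildBoundary_eq (n : ℕ) :
    hochschildBoundary k R R n = barBoundary k R R n + signedFace k R n (Fin.last (n + 1)) :=
  Fin.sum_univ_castSucc _

theorem hochschildBoundary_one_sub (n : ℕ) :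
    hochschildBoundary k R R n ∘ₗ (1 - cyclicOp k R (n + 1)) =
      (1 - cyclicOp k R n) ∘ₗ barBoundary k R R n := by
  have h : hochschildBoundary k R R n ∘ₗ cyclicOp k R (n + 1) =
      signedFace k R n (Fin.last (n + 1)) + cyclicOp k R n ∘ₗ barBoundary k R R n := by
    have : hochschildBoundary k R R n =
        signedFace k R n 0 + ∑ i : Fin (n + 1), signedFace k R n i.succ := Fin.sum_univ_succ _
    rw [this, LinearMap.add_comp, signedFace_zero, sum_comp]
    simp only [signedFace_succ, ← comp_sum]
    rfl
  rw [LinearMap.comp_sub, h, LinearMap.sub_comp, hochschildBoundary_eq]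
  simp only [Module.End.one_eq_id, LinearMap.comp_id, LinearMap.id_comp]
  abel

theorem cyclicOp_mul_normOp (n : ℕ) : cyclicOp k R n * normOp k R n = normOp k R n := by
  have := mul_geom_sum (cyclicOp k R n) (n + 1)
  rw [cyclicOp_pow, sub_self, sub_mul, one_mul, sub_eq_zero] at this
  exact this

theorem normOp_mul_cyclicOp (n : ℕ) : normOp k R n * cyclicOp k R n = normOp k R n := by
  have := geom_sum_mul (cyclicOp k R n) (n + 1)
  rw [cyclicOp_pow, sub_self, mul_sub, mul_one, sub_eq_zero] at this
  exact this

theorem signedFace_comp_normOp (n : ℕ) (i : ℕ) (hi : i < n + 2) :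
    signedFace k R n ⟨i, hi⟩ ∘ₗ normOp k R (n + 1) =
      (cyclicOp k R n ^ i) ∘ₗ signedFace k R n 0 ∘ₗ normOp k R (n + 1) := by
  induction i with
  | zero => rfl
  | succ i ih =>
    have h := signedFace_succ k R n ⟨i, by omega⟩
    rw [← cyclicOp_mul_normOp, Module.End.mul_eq_comp, ← LinearMap.comp_assoc]
    rw [Fin.succ_mk, Fin.castSucc_mk] at h
    rw [h, LinearMap.comp_assoc, ih (by omega), pow_succ', Module.End.mul_eq_comp,
      LinearMap.comp_assoc, ← Module.End.mul_eq_comp _ (normOp k R (n + 1)), cyclicOp_mul_normOp]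

theorem normOp_comp_signedFace (n : ℕ) (j : ℕ) (hj : j < n + 2) :
    normOp k R n ∘ₗ signedFace k R n ⟨n + 1 - j, by omega⟩ =
      normOp k R n ∘ₗ signedFace k R n 0 ∘ₗ (cyclicOp k R (n + 1) ^ (j + 1)) := by
  induction j with
  | zero => rw [zero_add, pow_one, signedFace_zero]; rfl
  | succ j ih =>
    have h := signedFace_succ k R n ⟨n - j, by omega⟩
    have e : (⟨n - j, by omega⟩ : Fin (n + 1)).succ = ⟨n + 1 - j, by omega⟩ :=
      Fin.ext (by simp; omega)
    have e' : (⟨n - j, by omega⟩ : Fin (n + 1)).castSucc = ⟨n + 1 - (j + 1), by omega⟩ :=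
      Fin.ext (by simp)
    rw [e, e'] at h
    rw [pow_succ, Module.End.mul_eq_comp, ← LinearMap.comp_assoc, ← LinearMap.comp_assoc,
      LinearMap.comp_assoc _ _ (normOp k R n), ← ih (by omega), LinearMap.comp_assoc, h,
      ← LinearMap.comp_assoc, ← Module.End.mul_eq_comp, normOp_mul_cyclicOp]

theorem barBoundary_comp_normOp (n : ℕ) :
    barBoundary k R R n ∘ₗ normOp k R (n + 1) = normOp k R n ∘ₗ hochschildBoundary k R R n := by
  trans normOp k R n ∘ₗ signedFace k R n 0 ∘ₗ normOp k R (n + 1)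
  · have : barBoundary k R R n = ∑ i : Fin (n + 1), signedFace k R n i.castSucc := rfl
    rw [this, sum_comp, normOp.eq_1 k R n, sum_comp, Finset.sum_range]
    exact Finset.sum_congr rfl fun i _ => signedFace_comp_normOp k R n i (by omega)
  · have : hochschildBoundary k R R n = ∑ i : Fin (n + 2), signedFace k R n i := rfl
    rw [this, comp_sum, ← cyclicOp_mul_normOp k R (n + 1), normOp.eq_1 k R (n + 1),
      Finset.mul_sum, comp_sum, comp_sum, ← Equiv.sum_comp Fin.revPerm, Finset.sum_range]
    refine Finset.sum_congr rfl fun i _ => ?_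
    have := normOp_comp_signedFace k R n i (by omega)
    rw [← pow_succ', ← this]
    congr 2
    refine Fin.ext ?_
    simp only [Fin.revPerm_apply, Fin.val_rev]
    omega

/-- The vertical differential of the cyclic bicomplex in column `p`: it is `b` for even `p` and
`-b'` for odd `p`. -/
def vertical (p n : ℕ) : Chains k R R (n + 1) →ₗ[k] Chains k R R n :=
  if Even p then hochschildBoundary k R R n else -barBoundary k R R n

/-- The horizontal differential of the cyclic bicomplex from column `p ≥ 1` to column `p - 1`, in
row `n`: it is `1 - t` for odd `p` and `N` for even `p`. -/
def horizontal (p n : ℕ) : Module.End k (Chains k R R n) :=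
  if Even p then normOp k R n else 1 - cyclicOp k R n

theorem vertical_comp_vertical (p n : ℕ) : vertical k R p n ∘ₗ vertical k R p (n + 1) = 0 := by
  unfold vertical
  split_ifs
  · exact hochschildBoundary_comp k n
  · rw [LinearMap.neg_comp, LinearMap.comp_neg, barBoundary_comp, neg_zero, neg_zero]

theorem horizontal_comp_horizontal (p n : ℕ) :
    horizontal k R p n ∘ₗ horizontal k R (p + 1) n = 0 := by
  rw [← Module.End.mul_eq_comp]
  by_cases h : Even p <;>
    simp [horizontal, h, Nat.even_add_one, mul_sub, sub_mul, cyclicOp_mul_normOp,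
      normOp_mul_cyclicOp]

theorem vertical_comp_horizontal (p n : ℕ) :
    vertical k R p n ∘ₗ horizontal k R (p + 1) (n + 1) +
      horizontal k R (p + 1) n ∘ₗ vertical k R (p + 1) n = 0 := by
  by_cases h : Even p
  · simp [horizontal, vertical, h, Nat.even_add_one, hochschildBoundary_one_sub,
      LinearMap.comp_neg]
  · simp [horizontal, vertical, h, Nat.even_add_one, barBoundary_comp_normOp, LinearMap.neg_comp]

/-- The total module `⨁_{p + q = n} C_q(R, R)` of the cyclic bicomplex, which has `C_q(R, R)` in
each bidegree `(p, q)` with `p, q ≥ 0`; the component `q` lies in column `p = n - q`. -/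
abbrev CyclicTotal (n : ℕ) : Type (max u v) := (q : Fin (n + 1)) → Chains k R R (q : ℕ)

/-- The total differential, horizontal plus vertical: the component of `d x` in row `q`, which lies
in column `n - q`, receives the vertical differential of the component of `x` in row `q + 1` and the
horizontal differential of the component of `x` in row `q`, column `n + 1 - q`. -/
def cyclicBoundary (n : ℕ) : CyclicTotal k R (n + 1) →ₗ[k] CyclicTotal k R n :=
  LinearMap.pi fun q =>
    vertical k R (n - q) q ∘ₗ LinearMap.proj (φ := fun i : Fin (n + 2) => Chains k R R (i : ℕ)) q.succ +
      horizontal k R (n + 1 - q) q ∘ₗ LinearMap.proj (φ := fun i : Fin (n + 2) => Chains k R R (i : ℕ)) q.castSucc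

theorem cyclicBoundary_comp (n : ℕ) : cyclicBoundary k R n ∘ₗ cyclicBoundary k R (n + 1) = 0 := by
  refine LinearMap.ext fun x => funext fun q => ?_
  have hq : (q : ℕ) ≤ n := by omega
  have e1 : n + 1 - (q + 1) = n - (q : ℕ) := by omega
  have e2 : n + 1 + 1 - (q + 1) = n - (q : ℕ) + 1 := by omega
  have e3 : n + 1 - (q : ℕ) = n - q + 1 := by omega
  have e4 : n + 1 + 1 - (q : ℕ) = n - q + 1 + 1 := by omega
  have h1 := LinearMap.congr_fun (vertical_comp_vertical k R (n - q) q) (x q.succ.succ)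
  have h2 := LinearMap.congr_fun (vertical_comp_horizontal k R (n - q) q) (x q.succ.castSucc)
  have h3 := LinearMap.congr_fun (horizontal_comp_horizontal k R (n - q + 1) q)
    (x q.castSucc.castSucc)
  simp only [LinearMap.comp_apply, LinearMap.add_apply, LinearMap.zero_apply] at h1 h2 h3
  simp only [cyclicBoundary, LinearMap.comp_apply, LinearMap.pi_apply, LinearMap.add_apply,
    LinearMap.proj_apply, map_add, Fin.val_succ, Fin.val_castSucc, e1, e2, e3, e4,
    LinearMap.zero_apply, Pi.zero_apply]
  rw [h1, h3, zero_add, add_zero]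
  exact h2

end Cyclic

/-! ### Hochschild and cyclic homology -/

section Homology

variable {k : Type v} [CommRing k]

section Hochschild

variable {R R' R'' : Type u} [Ring R] [Ring R'] [Ring R''] [Algebra k R] [Algebra k R']
  [Algebra k R'']

/-- The Hochschild complex `(C_•(R, M), b)`. -/
def hochschildComplex (M : Bimodule k R R) : ChainComplex (ModuleCat.{max u v} k) ℕ :=
  ChainComplex.of (fun n => ModuleCat.of k (Chains k R M n))
    (fun n => ModuleCat.ofHom (hochschildBoundary k R M n))
    fun n => by
      rw [← ModuleCat.ofHom_comp, hochschildBoundary_comp]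
      rfl

/-- The Hochschild homology `H_n(R, M)`. -/
def hochschildHomology (n : ℕ) (M : Bimodule k R R) : ModuleCat.{max u v} k :=
  (hochschildComplex M).homology n

/-- The chain map induced by an algebra morphism `f : R → R'` and a morphism `M → M'` over it. -/
def hochschildComplexMap {f : R →ₐ[k] R'} {M : Bimodule k R R} {M' : Bimodule k R' R'}
    (μ : Bimodule.HomOver f f M M') : hochschildComplex M ⟶ hochschildComplex M' :=
  ChainComplex.ofHom (fun n => ModuleCat.ofHom (chainsMap k f μ.toLinearMap n)) fun n => by
    simp only [hochschildComplex, ChainComplex.of_d]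
    erw [← ModuleCat.ofHom_comp, ← ModuleCat.ofHom_comp]
    rw [hochschildBoundary_comp_chainsMap k f _ μ.map_smul μ.map_op_smul]

/-- The induced map `H_n(R, M) → H_n(R', M')`. -/
def hochschildHomologyMap (n : ℕ) {f : R →ₐ[k] R'} {M : Bimodule k R R} {M' : Bimodule k R' R'}
    (μ : Bimodule.HomOver f f M M') : hochschildHomology n M ⟶ hochschildHomology n M' :=
  HomologicalComplex.homologyMap (hochschildComplexMap μ) n

end Hochschild

section CyclicHomology

variable (k) (R : Type u) {R' : Type u} [Ring R] [Ring R'] [Algebra k R] [Algebra k R']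

/-- The total complex of the cyclic bicomplex of `R`. -/
def cyclicComplex : ChainComplex (ModuleCat.{max u v} k) ℕ :=
  ChainComplex.of (fun n => ModuleCat.of k (CyclicTotal k R n))
    (fun n => ModuleCat.ofHom (cyclicBoundary k R n))
    fun n => by
      rw [← ModuleCat.ofHom_comp, cyclicBoundary_comp]
      rfl

/-- The cyclic homology `HC_n(R)`. -/
def cyclicHomology (n : ℕ) : ModuleCat.{max u v} k := (cyclicComplex k R).homology n

variable {k R} (f : R →ₐ[k] R')

theorem cyclicOp_comp_chainsMap (n : ℕ) :
    cyclicOp k R' n ∘ₗ chainsMap k f f.toLinearMap n =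
      chainsMap k f f.toLinearMap n ∘ₗ cyclicOp k R n := by
  have : rot k R' n ∘ₗ chainsMap k f f.toLinearMap n =
      chainsMap k f f.toLinearMap n ∘ₗ rot k R n := chains_hom_ext fun x => by
    simp only [LinearMap.comp_apply, chainsMap_pureTensor, rot_pureTensor]
    congr 1
    cases n with
    | zero => rfl
    | succ n =>
      refine Prod.ext rfl (funext fun j => ?_)
      refine Fin.cases rfl (fun j => rfl) j
  simp only [cyclicOp, LinearMap.smul_comp, LinearMap.comp_smul, this]

theorem normOp_comp_chainsMap (n : ℕ) :
    normOp k R' n ∘ₗ chainsMap k f f.toLinearMap n =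
      chainsMap k f f.toLinearMap n ∘ₗ normOp k R n := by
  have (j : ℕ) : (cyclicOp k R' n ^ j) ∘ₗ chainsMap k f f.toLinearMap n =
      chainsMap k f f.toLinearMap n ∘ₗ (cyclicOp k R n ^ j) := by
    induction j with
    | zero => rfl
    | succ j ih =>
      rw [pow_succ, pow_succ, Module.End.mul_eq_comp, Module.End.mul_eq_comp, LinearMap.comp_assoc,
        cyclicOp_comp_chainsMap, ← LinearMap.comp_assoc, ih, LinearMap.comp_assoc]
  simp only [normOp, sum_comp, comp_sum, this]

theorem horizontal_comp_chainsMap (p n : ℕ) :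
    horizontal k R' p n ∘ₗ chainsMap k f f.toLinearMap n =
      chainsMap k f f.toLinearMap n ∘ₗ horizontal k R p n := by
  unfold horizontal
  split_ifs
  · exact normOp_comp_chainsMap f n
  · rw [LinearMap.sub_comp, LinearMap.comp_sub, cyclicOp_comp_chainsMap]
    rfl

theorem vertical_comp_chainsMap (p n : ℕ) :
    vertical k R' p n ∘ₗ chainsMap k f f.toLinearMap (n + 1) =
      chainsMap k f f.toLinearMap n ∘ₗ vertical k R p n := by
  unfold vertical
  split_ifs
  · exact hochschildBoundary_comp_chainsMap k f f.toLinearMap (fun a x => map_mul f a x)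
      (fun a x => map_mul f x a) n
  · rw [LinearMap.neg_comp, LinearMap.comp_neg,
      barBoundary_comp_chainsMap k f f.toLinearMap (fun a x => map_mul f a x)
      (fun a x => map_mul f x a) n]

/-- The map of total modules induced by an algebra morphism. -/
def cyclicTotalMap (n : ℕ) : CyclicTotal k R n →ₗ[k] CyclicTotal k R' n :=
  LinearMap.pi fun q => chainsMap k f f.toLinearMap q ∘ₗ
    LinearMap.proj (φ := fun i : Fin (n + 1) => Chains k R R (i : ℕ)) q

theorem cyclicBoundary_comp_cyclicTotalMap (n : ℕ) :
    cyclicBoundary k R' n ∘ₗ cyclicTotalMap f (n + 1) =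
      cyclicTotalMap f n ∘ₗ cyclicBoundary k R n := by
  refine LinearMap.ext fun x => funext fun q => ?_
  have h1 := LinearMap.congr_fun (vertical_comp_chainsMap f (n - q) q) (x q.succ)
  have h2 := LinearMap.congr_fun (horizontal_comp_chainsMap f (n + 1 - q) q) (x q.castSucc)
  exact (congrArg₂ (· + ·) h1 h2).trans (map_add (chainsMap k f f.toLinearMap q) _ _).symm

/-- The chain map of cyclic complexes induced by an algebra morphism. -/
def cyclicComplexMap : cyclicComplex k R ⟶ cyclicComplex k R' :=
  ChainComplex.ofHom (fun n => ModuleCat.ofHom (cyclicTotalMap f n)) fun n => by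
    simp only [cyclicComplex, ChainComplex.of_d]
    erw [← ModuleCat.ofHom_comp, ← ModuleCat.ofHom_comp]
    rw [cyclicBoundary_comp_cyclicTotalMap]

/-- The induced map `HC_n(R) → HC_n(R')`. -/
def cyclicHomologyMap (n : ℕ) : cyclicHomology k R n ⟶ cyclicHomology k R' n :=
  HomologicalComplex.homologyMap (cyclicComplexMap f) n

end CyclicHomology

end Homology

end

end MoritaInvariance

/-!
A decomposition `1 = ∑ ψ(qᵢ ⊗ pᵢ)` turns `R` into a (non-unital) subalgebra of the matrices over
`S`, through `r ↦ (φ(pᵢ r ⊗ qⱼ))`, and `M` into matrices over `P ⊗_R M ⊗_R Q`, through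
`m ↦ (pᵢ ⊗ m ⊗ qⱼ)`; the generalized trace of matrices then gives a map of complexes. A
decomposition of the unit of `S` gives a map in the other direction, and both composites are the
generalized traces of conjugations `x ↦ (bᵢ x aⱼ)` with `∑ aᵢ bᵢ = 1`.

On Hochschild chains, a conjugation is homotopic to the identity by insertion of the conjugating
elements. These homotopies do not respect the cyclic operators. Together with the contraction of the
bar complex they nevertheless give a homotopy in each column of the cyclic bicomplex, so on the
total complex a conjugation is, up to homotopy, the identity minus a map raising the filtration by
rows: it is an isomorphism on cyclic homology. Applied to matrix units, this makes the trace of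
matrices a monomorphism, so that all its sections `x ↦ x Eᵢᵢ` agree on homology. A conjugation and
the identity both factor through one map of matrix algebras, by two such sections, hence every
conjugation is the identity on cyclic homology.

The inverse of a transfer map depends only on the decomposition of the unit of `S`, so the transfer
map does not depend on the decomposition of the unit of `R`, and naturality follows since a morphism
of Morita contexts carries decompositions to decompositions.
-/

namespace MoritaInvariance

noncomputable section

variable {k : Type v} [CommRing k]

/-! ### Non-unital morphisms and matrix bimodules -/

section MatrixBimodule

variable {A B C : Type u} [Ring A] [Ring B] [Ring C] [Algebra k A] [Algebra k B] [Algebra k C]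

/-- A morphism of bimodules along a multiplicative, not necessarily unital, morphism of algebras.
For `N` a bimodule of matrices it describes a matrix-valued morphism, along which a generalized
trace is defined. -/
structure NonUnitalHomOver (F : A →ₙₐ[k] B) (M : Bimodule k A A) (N : Bimodule k B B) where
  toLinearMap : M →ₗ[k] N
  map_smul : ∀ (a : A) (m : M), toLinearMap (a • m) = F a • toLinearMap m
  map_op_smul : ∀ (a : A) (m : M), toLinearMap (op a • m) = op (F a) • toLinearMap m

/-- The identity of a bimodule. -/
def NonUnitalHomOver.id (M : Bimodule k A A) : NonUnitalHomOver (NonUnitalAlgHom.id k A) M M where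
  toLinearMap := LinearMap.id
  map_smul _ _ := rfl
  map_op_smul _ _ := rfl

namespace Bimodule

variable (N : Bimodule k B B) (ι : Type) [Fintype ι] [DecidableEq ι]

open scoped Matrix.Module in
/-- The bimodule of square matrices with entries in `N`, over the algebra of square matrices. -/
def matrix : Bimodule k (Matrix ι ι B) (Matrix ι ι B) :=
  letI left : Module (Matrix ι ι B) (Matrix ι ι N) := Matrix.Module.matrixModule (M := ι → N)
  letI row : Module (Matrix ι ι B)ᵐᵒᵖ (ι → N) :=
    Module.compHom (ι → N) (RingEquiv.mopMatrix (m := ι) (α := B)).symm.toRingHom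
  letI right : Module (Matrix ι ι B)ᵐᵒᵖ (Matrix ι ι N) := Pi.module ι (fun _ => ι → N) _
  have left_apply (X : Matrix ι ι B) (m : Matrix ι ι N) (i j : ι) :
      (X • m) i j = ∑ l, X i l • m l j := Finset.sum_apply j _ _
  have right_apply (X : (Matrix ι ι B)ᵐᵒᵖ) (m : Matrix ι ι N) (i j : ι) :
      (X • m) i j = ∑ l, op (X.unop l j) • m i l := rfl
  { carrier := Matrix ι ι N
    left
    right
    leftTower := ⟨fun c X m => by
      ext i j
      simp only [left_apply, Matrix.smul_apply, smul_assoc, Finset.smul_sum]⟩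
    rightTower := ⟨fun c X m => by
      ext i j
      simp only [right_apply, unop_smul, op_smul, Matrix.smul_apply, smul_assoc, Finset.smul_sum]⟩
    comm := ⟨fun X Y m => by
      ext i j
      simp only [left_apply, right_apply, Finset.smul_sum]
      rw [Finset.sum_comm]
      exact Finset.sum_congr rfl fun l _ => Finset.sum_congr rfl fun l' _ => smul_comm _ _ _⟩ }

variable {ι N}

/-- The coefficient of index `(i, j)`, as a linear map on the bimodule of matrices. -/
def matrixEntry (i j : ι) : N.matrix ι →ₗ[k] N :=
  Matrix.entryLinearMap k N i j

theorem matrix_ext {m m' : N.matrix ι} (h : ∀ i j, matrixEntry i j m = matrixEntry i j m') :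
    m = m' :=
  Matrix.ext h

theorem matrixEntry_smul (i j : ι) (X : Matrix ι ι B) (m : N.matrix ι) :
    matrixEntry i j (X • m) = ∑ l, X i l • matrixEntry l j m :=
  Finset.sum_apply j _ _

theorem matrixEntry_op_smul (i j : ι) (X : Matrix ι ι B) (m : N.matrix ι) :
    matrixEntry i j (op X • m) = ∑ l, op (X l j) • matrixEntry i l m :=
  rfl

end Bimodule

variable {ι : Type} [Fintype ι]

variable (k A B ι) in
/-- A matrix-valued morphism: a multiplicative, not necessarily unital, morphism from `A` to the
algebra of matrices over `B`. -/
abbrev MatAlgHom := A →ₙₐ[k] Matrix ι ι B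

namespace MatAlgHom

/-- The coefficient of index `(i, j)` of a matrix-valued morphism of algebras. -/
def entry (F : MatAlgHom k A B ι) (i j : ι) : A →ₗ[k] B :=
  Matrix.entryLinearMap k B i j ∘ₗ (F : A →ₗ[k] Matrix ι ι B)

theorem entry_mul (F : MatAlgHom k A B ι) (i j : ι) (x y : A) :
    F.entry i j (x * y) = ∑ l, F.entry i l x * F.entry l j y :=
  (congrFun₂ (map_mul F x y) i j).trans (Matrix.mul_apply ..)

/-- The matrix-valued morphism of algebras with given coefficients. -/
def ofEntries (f : ι → ι → A →ₗ[k] B) (h : ∀ i j x y, f i j (x * y) = ∑ l, f i l x * f l j y) :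
    MatAlgHom k A B ι where
  toFun x := Matrix.of fun i j => f i j x
  map_smul' c x := Matrix.ext fun i j => map_smul (f i j) c x
  map_zero' := Matrix.ext fun i j => map_zero (f i j)
  map_add' x y := Matrix.ext fun i j => map_add (f i j) x y
  map_mul' x y := Matrix.ext fun i j => h i j x y

end MatAlgHom

variable {M : Bimodule k A A} {N : Bimodule k B B} [DecidableEq ι]

variable (M N) in
/-- A matrix-valued morphism of bimodules, from `M` to matrices over `N`, along a matrix-valued
morphism of algebras. -/
abbrev MatHom (F : MatAlgHom k A B ι) := NonUnitalHomOver F M (N.matrix ι)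

namespace MatHom

variable {F : MatAlgHom k A B ι} (μ : MatHom M N F)

/-- The coefficient of index `(i, j)` of a matrix-valued morphism of bimodules. -/
def entry (i j : ι) : M →ₗ[k] N :=
  Bimodule.matrixEntry i j ∘ₗ μ.toLinearMap

theorem entry_smul (i j : ι) (x : A) (m : M) :
    μ.entry i j (x • m) = ∑ l, F.entry i l x • μ.entry l j m :=
  (congrArg _ (μ.map_smul x m)).trans (Bimodule.matrixEntry_smul i j _ _)

theorem entry_op_smul (i j : ι) (x : A) (m : M) :
    μ.entry i j (op x • m) = ∑ l, op (F.entry l j x) • μ.entry i l m :=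
  (congrArg _ (μ.map_op_smul x m)).trans (Bimodule.matrixEntry_op_smul i j _ _)

variable (F) in
/-- The matrix-valued morphism of bimodules with given coefficients. -/
def ofEntries (g : ι → ι → M →ₗ[k] N)
    (h : ∀ i j x m, g i j (x • m) = ∑ l, F.entry i l x • g l j m)
    (h' : ∀ i j x m, g i j (op x • m) = ∑ l, op (F.entry l j x) • g i l m) : MatHom M N F where
  toLinearMap := (LinearMap.pi fun i => LinearMap.pi (g i) : M →ₗ[k] ι → ι → N)
  map_smul x m := Bimodule.matrix_ext fun i j =>
    (h i j x m).trans (Bimodule.matrixEntry_smul (N := N) i j (F x) fun i j => g i j m).symm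
  map_op_smul x m := Bimodule.matrix_ext fun i j => h' i j x m

variable (F) in
/-- A matrix-valued morphism of algebras `A → B`, as a matrix-valued morphism of bimodules. -/
def self : MatHom (Bimodule.self k A) (Bimodule.self k B) F :=
  ofEntries F F.entry F.entry_mul fun i j x m => F.entry_mul i j m x

end MatHom

end MatrixBimodule

section Trace

variable {A B C M N L : Type u} [Ring A] [Ring B] [Ring C] [Algebra k A] [Algebra k B]
  [Algebra k C] [AddCommGroup M] [Module k M] [AddCommGroup N] [Module k N] [AddCommGroup L]
  [Module k L] {ι κ : Type} [Fintype ι] [Fintype κ]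

/-! ### Generalized traces -/

/-- The tensor product of linear maps of the coefficients and of each tensor factor. -/
def chainsTensorMap {n : ℕ} (g : M →ₗ[k] N) (f : Fin n → A →ₗ[k] B) :
    Chains k A M n →ₗ[k] Chains k B N n :=
  TensorProduct.map (M := M) (M₂ := N) g (PiTensorProduct.map f)

theorem chainsTensorMap_pureTensor {n : ℕ} (g : M →ₗ[k] N) (f : Fin n → A →ₗ[k] B)
    (x : M × (Fin n → A)) :
    chainsTensorMap g f (pureTensor k x) = pureTensor k (g x.1, fun j => f j (x.2 j)) :=
  (TensorProduct.map_tmul _ _ x.1 (PiTensorProduct.tprod k x.2)).trans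
    (congrArg _ (PiTensorProduct.map_tprod _ _))

/-- The tuple of coefficients `(g_{iₙ i₀}(m), f_{i₀ i₁}(r₁), …, f_{iₙ₋₁ iₙ}(rₙ))` along a closed
path of indices, `g` and `f` being the coefficients of matrix-valued morphisms. -/
def traceTuple (f : ι → ι → A →ₗ[k] B) (g : ι → ι → M →ₗ[k] N) {n : ℕ} (I : Fin (n + 1) → ι)
    (x : M × (Fin n → A)) : N × (Fin n → B) :=
  (g (I (Fin.last n)) (I 0) x.1, fun j => f (I j.castSucc) (I j.succ) (x.2 j))

/-- The generalized trace
`m ⊗ r₁ ⊗ ⋯ ⊗ rₙ ↦ ∑ g_{iₙ i₀}(m) ⊗ f_{i₀ i₁}(r₁) ⊗ ⋯ ⊗ f_{iₙ₋₁ iₙ}(rₙ)`. -/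
def traceMap (f : ι → ι → A →ₗ[k] B) (g : ι → ι → M →ₗ[k] N) (n : ℕ) :
    Chains k A M n →ₗ[k] Chains k B N n :=
  ∑ I : Fin (n + 1) → ι,
    chainsTensorMap (g (I (Fin.last n)) (I 0)) fun j => f (I j.castSucc) (I j.succ)

theorem traceMap_pureTensor (f : ι → ι → A →ₗ[k] B) (g : ι → ι → M →ₗ[k] N) {n : ℕ}
    (x : M × (Fin n → A)) :
    traceMap f g n (pureTensor k x) = ∑ I : Fin (n + 1) → ι, pureTensor k (traceTuple f g I x) :=
  (LinearMap.sum_apply _ _ _).trans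
    (Finset.sum_congr rfl fun _ _ => chainsTensorMap_pureTensor _ _ x)

theorem traceMap_comp (f : ι → ι → A →ₗ[k] B) (g : ι → ι → M →ₗ[k] N) (f' : κ → κ → B →ₗ[k] C)
    (g' : κ → κ → N →ₗ[k] L) (n : ℕ) :
    traceMap f' g' n ∘ₗ traceMap f g n =
      traceMap (fun i j : ι × κ => f' i.2 j.2 ∘ₗ f i.1 j.1) (fun i j => g' i.2 j.2 ∘ₗ g i.1 j.1)
        n :=
  chains_hom_ext fun x => by
    simp only [LinearMap.comp_apply, traceMap_pureTensor, map_sum]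
    rw [← (Equiv.arrowProdEquivProdArrow (Fin (n + 1)) (fun _ => ι) (fun _ => κ)).symm.sum_comp,
      Fintype.sum_prod_type]
    rfl

theorem traceMap_comp_chainsTensorMap (f : ι → ι → B →ₗ[k] C) (g : ι → ι → N →ₗ[k] L)
    (f' : A →ₗ[k] B) (g' : M →ₗ[k] N) (n : ℕ) :
    traceMap f g n ∘ₗ chainsTensorMap g' (fun _ => f') =
      traceMap (fun i j => f i j ∘ₗ f') (fun i j => g i j ∘ₗ g') n :=
  chains_hom_ext fun x => by
    rw [LinearMap.comp_apply, chainsTensorMap_pureTensor, traceMap_pureTensor, traceMap_pureTensor]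
    rfl

theorem traceMap_of_unique [Unique ι] (f : ι → ι → A →ₗ[k] B) (g : ι → ι → M →ₗ[k] N) {n : ℕ}
    (x : M × (Fin n → A)) : traceMap f g n (pureTensor k x) =
      pureTensor k (g default default x.1, fun j => f default default (x.2 j)) := by
  rw [traceMap_pureTensor, Fintype.sum_unique]
  exact congrArg _ (Prod.ext (congrFun₂ (by rfl) _ _) rfl)

theorem pureTensor_eq_zero_left {n : ℕ} {x : M × (Fin n → A)} (h : x.1 = 0) :
    pureTensor k x = 0 := by
  rw [pureTensor, h]
  exact TensorProduct.zero_tmul _ _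

theorem pureTensor_eq_zero_right {n : ℕ} {x : M × (Fin n → A)} (i : Fin n) (h : x.2 i = 0) :
    pureTensor k x = 0 := by
  rw [pureTensor, MultilinearMap.map_coord_zero _ i h]
  exact TensorProduct.tmul_zero _ _

theorem traceMap_eq_of_injective {f : ι → ι → A →ₗ[k] B} {g : ι → ι → M →ₗ[k] N}
    {f' : κ → κ → A →ₗ[k] B} {g' : κ → κ → M →ₗ[k] N} (e : ι → κ) (he : Function.Injective e)
    (hf : ∀ i j, f' (e i) (e j) = f i j) (hg : ∀ i j, g' (e i) (e j) = g i j)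
    (hf0 : ∀ i j, i ∉ Set.range e → f' j i = 0) (hg0 : ∀ i j, i ∉ Set.range e → g' j i = 0)
    (n : ℕ) : traceMap f' g' n = traceMap f g n :=
  chains_hom_ext fun x => by
    rw [traceMap_pureTensor, traceMap_pureTensor]
    refine (Finset.sum_of_injOn (fun I => e ∘ I) he.comp_left.injOn (by simp) ?_ ?_).symm
    · rintro I - hI
      obtain ⟨a, ha⟩ : ∃ a, I a ∉ Set.range e := by
        by_contra! h
        choose J hJ using h
        exact hI ⟨J, by simp, funext hJ⟩
      obtain rfl | ⟨a, rfl⟩ := Fin.eq_zero_or_eq_succ a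
      · exact pureTensor_eq_zero_left (LinearMap.congr_fun (hg0 _ _ ha) x.1)
      · exact pureTensor_eq_zero_right a (LinearMap.congr_fun (hf0 _ _ ha) (x.2 a))
    · rintro I -
      simp only [traceTuple, Function.comp_apply, hf, hg]

theorem chainsMap_comp_traceMap {A' B' M' N' : Type u} [Ring A'] [Ring B'] [Algebra k A']
    [Algebra k B'] [AddCommGroup M'] [Module k M'] [AddCommGroup N'] [Module k N']
    {f : ι → ι → A →ₗ[k] B} {g : ι → ι → M →ₗ[k] N} {f' : ι → ι → A' →ₗ[k] B'}
    {g' : ι → ι → M' →ₗ[k] N'} (α : A →ₐ[k] A') (β : B →ₐ[k] B') (μ : M →ₗ[k] M')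
    (ν : N →ₗ[k] N') (hf : ∀ i j a, β (f i j a) = f' i j (α a))
    (hg : ∀ i j m, ν (g i j m) = g' i j (μ m)) (n : ℕ) :
    chainsMap k β ν n ∘ₗ traceMap f g n = traceMap f' g' n ∘ₗ chainsMap k α μ n :=
  chains_hom_ext fun x => by
    simp only [LinearMap.comp_apply, traceMap_pureTensor, map_sum, chainsMap_pureTensor, traceTuple,
      hf, hg]

end Trace

/-! ### Generalized traces commute with the faces -/

section PureTensor

variable {A M : Type u} [Ring A] [Algebra k A] [AddCommGroup M] [Module k M]

theorem pureTensor_sum {n : ℕ} {ι : Type*} (s : Finset ι) (m : ι → M) (r : Fin n → A) :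
    pureTensor k (∑ l ∈ s, m l, r) = ∑ l ∈ s, pureTensor k (m l, r) :=
  TensorProduct.sum_tmul s m _

theorem pureTensor_update_sum {n : ℕ} {ι : Type*} (s : Finset ι) (m : M) (r : Fin n → A)
    (i : Fin n) (a : ι → A) :
    pureTensor k (m, Function.update r i (∑ l ∈ s, a l)) =
      ∑ l ∈ s, pureTensor k (m, Function.update r i (a l)) := by
  simp only [pureTensor, MultilinearMap.map_update_sum]
  exact TensorProduct.tmul_sum _ _ _

end PureTensor

section Faces

variable {A M : Type u} [Ring A] [AddCommGroup M] [Module A M] [Module Aᵐᵒᵖ M] {n : ℕ}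

theorem faceTuple_zero (x : M × (Fin (n + 1) → A)) :
    faceTuple 0 x = (op (x.2 0) • x.1, Fin.tail x.2) :=
  rfl

theorem faceTuple_last (x : M × (Fin (n + 1) → A)) :
    faceTuple (Fin.last (n + 1)) x = (x.2 (Fin.last n) • x.1, Fin.init x.2) := by
  refine Prod.ext (by simp [faceTuple]) (funext fun j => ?_)
  exact if_pos (Nat.succ_lt_succ j.2)

theorem faceTuple_succ_castSucc (s : Fin n) (x : M × (Fin (n + 1) → A)) :
    faceTuple s.castSucc.succ x = (x.1, s.castSucc.contractNth (· * ·) x.2) :=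
  Prod.ext (by simp [faceTuple, s.2.ne]) (funext fun j => by simp [faceTuple, Fin.contractNth])

theorem faceTuple_traceTuple_insertNth [Algebra k A] [Module k M] {B N : Type u} [Ring B]
    [Algebra k B] [AddCommGroup N] [Module k N] [Module B N] [Module Bᵐᵒᵖ N] {ι : Type}
    (f : ι → ι → A →ₗ[k] B) (g : ι → ι → M →ₗ[k] N)
    (s : Fin n) (x : M × (Fin (n + 1) → A)) (I : Fin (n + 1) → ι) (l : ι) :
    faceTuple s.castSucc.succ (traceTuple f g (s.castSucc.succ.insertNth l I) x) =
      (g (I (Fin.last n)) (I 0) x.1,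
        Function.update (traceTuple f g I (faceTuple s.castSucc.succ x)).2 s
          (f (I s.castSucc) l (x.2 s.castSucc) * f l (I s.succ) (x.2 s.succ))) := by
  have below (a : Fin (n + 1)) (h : a ≤ s.castSucc) :
      (s.castSucc.succ.insertNth l I : Fin (n + 2) → ι) a.castSucc = I a := by
    rw [← Fin.succAbove_of_castSucc_lt _ _ (Fin.castSucc_lt_succ_iff.2 h),
      Fin.insertNth_apply_succAbove]
  have above (a : Fin (n + 1)) (h : s.castSucc < a) :
      (s.castSucc.succ.insertNth l I : Fin (n + 2) → ι) a.succ = I a := by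
    rw [← Fin.succAbove_of_lt_succ _ _ (Fin.succ_lt_succ_iff.2 h), Fin.insertNth_apply_succAbove]
  have same := Fin.insertNth_apply_same (α := fun _ => ι) s.castSucc.succ l I
  simp only [faceTuple_succ_castSucc]
  refine Prod.ext ?_ (funext fun j => ?_)
  · simp only [traceTuple]
    rw [← Fin.succ_last, above _ s.castSucc_lt_last, ← Fin.castSucc_zero, below _ (Fin.zero_le _)]
  · dsimp only [traceTuple]
    rcases lt_trichotomy j s with h | rfl | h
    · have h' : (j : ℕ) < s.castSucc := h
      rw [Fin.contractNth_apply_of_lt _ _ _ _ h', Function.update_of_ne h.ne,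
        Fin.contractNth_apply_of_lt _ _ _ _ h', below _ (Fin.castSucc_le_castSucc_iff.2 h.le),
        Fin.succ_castSucc j, below _ (Fin.succ_le_castSucc_iff.2 h)]
    · rw [Fin.contractNth_apply_of_eq _ _ _ _ rfl, Function.update_self, below _ le_rfl, same,
        ← Fin.succ_castSucc, same, above _ Fin.castSucc_lt_succ]
    · have h' : (s.castSucc : ℕ) < j := h
      rw [Fin.contractNth_apply_of_gt _ _ _ _ h', Function.update_of_ne h.ne',
        Fin.contractNth_apply_of_gt _ _ _ _ h', ← Fin.succ_castSucc,
        above _ (Fin.castSucc_lt_castSucc_iff.2 h), above _ (Fin.castSucc_lt_succ_iff.2 h.le)]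

end Faces

section FaceTrace

variable {A B : Type u} [Ring A] [Ring B] [Algebra k A] [Algebra k B]
  {M : Bimodule k A A} {N : Bimodule k B B} {ι : Type} [Fintype ι] [DecidableEq ι]
  {F : MatAlgHom k A B ι} (μ : MatHom M N F) {n : ℕ}

theorem sum_pureTensor_faceTuple_zero (x : M × (Fin (n + 1) → A)) (I : Fin (n + 1) → ι) :
    ∑ l, pureTensor k (faceTuple 0 (traceTuple F.entry μ.entry (Fin.insertNth 0 l I) x)) =
      pureTensor k (traceTuple F.entry μ.entry I (faceTuple 0 x)) := by
  have key (l : ι) : faceTuple 0 (traceTuple F.entry μ.entry (Fin.insertNth 0 l I) x) =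
      (op (F.entry l (I 0) (x.2 0)) • μ.entry (I (Fin.last n)) l x.1,
        fun j => F.entry (I j.castSucc) (I j.succ) (x.2 j.succ)) := by
    rw [faceTuple_zero, Fin.insertNth_zero']
    refine Prod.ext ?_ (funext fun j => ?_)
    · simp only [traceTuple, Fin.castSucc_zero, Fin.cons_zero, Fin.cons_succ]
      rw [← Fin.succ_last, Fin.cons_succ]
    · simp only [traceTuple, Fin.tail, Fin.cons_succ, Fin.castSucc_succ]
  simp only [key, faceTuple_zero]
  rw [← pureTensor_sum, ← μ.entry_op_smul]
  rfl

theorem sum_pureTensor_faceTuple_last (x : M × (Fin (n + 1) → A)) (I : Fin (n + 1) → ι) :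
    ∑ l, pureTensor k (faceTuple (Fin.last (n + 1))
        (traceTuple F.entry μ.entry ((Fin.last (n + 1)).insertNth l I) x)) =
      pureTensor k (traceTuple F.entry μ.entry I (faceTuple (Fin.last (n + 1)) x)) := by
  have key (l : ι) :
      faceTuple (Fin.last (n + 1))
          (traceTuple F.entry μ.entry ((Fin.last (n + 1)).insertNth l I) x) =
        (F.entry (I (Fin.last n)) l (x.2 (Fin.last n)) • μ.entry l (I 0) x.1,
          fun j => F.entry (I j.castSucc) (I j.succ) (x.2 j.castSucc)) := by
    rw [faceTuple_last, Fin.insertNth_last']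
    refine Prod.ext ?_ (funext fun j => ?_)
    · simp only [traceTuple, Fin.snoc_castSucc, Fin.succ_last, Fin.snoc_last]
      rw [← Fin.castSucc_zero, Fin.snoc_castSucc]
    · simp only [traceTuple, Fin.init, Fin.snoc_castSucc, Fin.succ_castSucc]
  simp only [key, faceTuple_last]
  rw [← pureTensor_sum, ← μ.entry_smul]
  rfl

theorem sum_pureTensor_faceTuple_succ_castSucc (s : Fin n) (x : M × (Fin (n + 1) → A))
    (I : Fin (n + 1) → ι) :
    ∑ l, pureTensor k (faceTuple s.castSucc.succ
        (traceTuple F.entry μ.entry (s.castSucc.succ.insertNth l I) x)) =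
      pureTensor k (traceTuple F.entry μ.entry I (faceTuple s.castSucc.succ x)) := by
  simp only [faceTuple_traceTuple_insertNth]
  rw [← pureTensor_update_sum, ← F.entry_mul, faceTuple_succ_castSucc]
  refine congrArg _ (Prod.ext rfl (Function.update_eq_self_iff.2 ?_))
  exact congrArg _ (Fin.contractNth_apply_of_eq s.castSucc (· * ·) x.2 s rfl).symm

theorem face_comp_traceMap (i : Fin (n + 2)) :
    face k i ∘ₗ traceMap F.entry μ.entry (n + 1) = traceMap F.entry μ.entry n ∘ₗ face k i :=
  chains_hom_ext fun x => by
    simp only [LinearMap.comp_apply, traceMap_pureTensor, map_sum, face_pureTensor]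
    rw [← (Fin.insertNthEquiv (fun _ => ι) i).sum_comp, Fintype.sum_prod_type_right]
    refine Finset.sum_congr rfl fun I _ => ?_
    induction i using Fin.cases with
    | zero => exact sum_pureTensor_faceTuple_zero μ x I
    | succ i =>
      induction i using Fin.lastCases with
      | last => exact sum_pureTensor_faceTuple_last μ x I
      | cast s => exact sum_pureTensor_faceTuple_succ_castSucc μ s x I

theorem hochschildBoundary_comp_traceMap (n : ℕ) :
    hochschildBoundary k B N n ∘ₗ traceMap F.entry μ.entry (n + 1) =
      traceMap F.entry μ.entry n ∘ₗ hochschildBoundary k A M n := by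
  simp only [hochschildBoundary, sum_comp, comp_sum, LinearMap.smul_comp, LinearMap.comp_smul,
    face_comp_traceMap]

theorem barBoundary_comp_traceMap (n : ℕ) :
    barBoundary k B N n ∘ₗ traceMap F.entry μ.entry (n + 1) =
      traceMap F.entry μ.entry n ∘ₗ barBoundary k A M n := by
  simp only [barBoundary, sum_comp, comp_sum, LinearMap.smul_comp, LinearMap.comp_smul,
    face_comp_traceMap]

end FaceTrace

/-! ### The presimplicial homotopy of a conjugation -/

section Alternating

variable {Z : Type*} [AddCommGroup Z] {n : ℕ}

theorem sum_succAbove_of_presimplicial_homotopy (D : Fin (n + 2) → Fin (n + 1) → Z)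
    (E : Fin n → Fin (n + 1) → Z) (hE : ∀ i j, i ≤ j.castSucc → D i.castSucc j.succ = E j i)
    (hE' : ∀ i j, j.castSucc < i → D i.succ j.castSucc = E j i) (i : Fin (n + 1)) :
    ∑ j : Fin (n + 1),
        ((-1 : ℤ) ^ (j : ℕ) * (-1) ^ (j.castSucc.succAbove i : ℕ)) • D (j.castSucc.succAbove i) j =
      - D i.succ i - ∑ j : Fin n, ((-1 : ℤ) ^ (j : ℕ) * (-1) ^ (i : ℕ)) • E j i := by
  rw [Fin.sum_univ_succAbove _ i, Fin.succAbove_castSucc_self, Fin.val_succ, pow_succ,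
    ← mul_assoc, ← mul_pow, sub_eq_add_neg, ← Finset.sum_neg_distrib]
  congr 1
  · simp
  refine Finset.sum_congr rfl fun j _ => ?_
  rcases lt_or_ge j.castSucc i with h | h
  · rw [Fin.succAbove_of_castSucc_lt _ _ h, Fin.succAbove_of_le_castSucc _ _
      (Fin.castSucc_le_castSucc_iff.2 h.le), hE' _ _ h, ← neg_smul]
    simp [pow_succ]
  · rw [Fin.succAbove_of_le_castSucc _ _ h, Fin.succAbove_of_castSucc_lt _ _
      (Fin.castSucc_lt_castSucc_iff.2 (h.trans_lt Fin.castSucc_lt_succ)), hE _ _ h, ← neg_smul]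
    simp [pow_succ]

theorem alternating_sum_of_presimplicial_homotopy (D : Fin (n + 2) → Fin (n + 1) → Z)
    (E : Fin n → Fin (n + 1) → Z) (K : Fin (n + 2) → Z)
    (hK : ∀ j, D j.castSucc j = K j.castSucc) (hK' : ∀ j, D j.succ j = K j.succ)
    (hE : ∀ i j, i ≤ j.castSucc → D i.castSucc j.succ = E j i)
    (hE' : ∀ i j, j.castSucc < i → D i.succ j.castSucc = E j i) :
    ∑ j : Fin (n + 1), ∑ i : Fin (n + 2), ((-1 : ℤ) ^ (j : ℕ) * (-1) ^ (i : ℕ)) • D i j =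
      K 0 - K (Fin.last _) -
        ∑ i : Fin (n + 1), ∑ j : Fin n, ((-1 : ℤ) ^ (j : ℕ) * (-1) ^ (i : ℕ)) • E j i := by
  have split_diagonal (j : Fin (n + 1)) :
      ∑ i : Fin (n + 2), ((-1 : ℤ) ^ (j : ℕ) * (-1) ^ (i : ℕ)) • D i j =
        K j.castSucc + ∑ i : Fin (n + 1), ((-1 : ℤ) ^ (j : ℕ) *
          (-1) ^ (j.castSucc.succAbove i : ℕ)) • D (j.castSucc.succAbove i) j := by
    rw [Fin.sum_univ_succAbove _ j.castSucc, hK, Fin.val_castSucc, ← mul_pow]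
    simp
  have telescope := (Fin.sum_univ_succ K).symm.trans (Fin.sum_univ_castSucc K)
  simp only [split_diagonal]
  rw [Finset.sum_add_distrib, Finset.sum_comm]
  simp only [sum_succAbove_of_presimplicial_homotopy D E hE hE', hK']
  rw [Finset.sum_sub_distrib, Finset.sum_neg_distrib, eq_sub_of_add_eq telescope.symm]
  abel

end Alternating

section InsertChain

variable {A M : Type u} [Ring A] [Algebra k A] [AddCommGroup M] [Module k M]

/-- The operator inserting a fixed algebra element at the `j`-th place. -/
def insertChain {n : ℕ} (j : Fin (n + 1)) (a : A) : Chains k A M n →ₗ[k] Chains k A M (n + 1) :=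
  chainsLift
    { toFun := fun m => MultilinearMap.mk' (fun r => pureTensor k (m, j.insertNth a r))
        (fun r i c c' => by simp only [Fin.insertNth_update, pureTensor_update_add])
        (fun r i t c => by simp only [Fin.insertNth_update, pureTensor_update_smul])
      map_add' := fun m m' => MultilinearMap.ext fun r => pureTensor_add k m m' _
      map_smul' := fun t m => MultilinearMap.ext fun r => pureTensor_smul k t m _ }

theorem insertChain_pureTensor {n : ℕ} (j : Fin (n + 1)) (a : A) (x : M × (Fin n → A)) :
    insertChain j a (pureTensor k x) = pureTensor k (x.1, j.insertNth a x.2) :=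
  chainsLift_pureTensor _ _

end InsertChain

theorem insertNth_apply_val {T : Type*} {n : ℕ} (i : Fin (n + 1)) (l : T) (I : Fin n → T)
    (a : Fin (n + 1)) : (i.insertNth l I : Fin (n + 1) → T) a =
      if h : (a : ℕ) < i then I ⟨a, by omega⟩ else
        if h' : (a : ℕ) = i then l else I ⟨a - 1, by omega⟩ := by
  rcases lt_trichotomy a i with h | rfl | h
  · rw [Fin.insertNth_apply_below h, dif_pos (Fin.lt_def.1 h), eq_rec_constant]
    rfl
  · rw [Fin.insertNth_apply_same, dif_neg (lt_irrefl _), dif_pos rfl]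
  · have := Fin.lt_def.1 h
    rw [Fin.insertNth_apply_above h, dif_neg (by omega), dif_neg (by omega), eq_rec_constant]
    rfl

section Conjugator

variable {A B : Type u} [Ring A] [Ring B] [Algebra k A] [Algebra k B]

/-- Elements `u`, `v` such that `u v` acts as the identity on the right of the images of a morphism
of algebras `F` and a morphism of bimodules `μ`, so that `a ↦ v F(a) u` and `m ↦ v μ(m) u` are
again such morphisms. -/
structure Conjugator {F : A →ₙₐ[k] B} {M : Bimodule k A A} {N : Bimodule k B B}
    (μ : NonUnitalHomOver F M N) where
  u : B
  v : B
  mul_u_mul_v : ∀ a, F a * u * v = F a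
  op_v_smul : ∀ m, op v • op u • μ.toLinearMap m = μ.toLinearMap m

namespace Conjugator

variable {F : A →ₙₐ[k] B} {M : Bimodule k A A} {N : Bimodule k B B} {μ : NonUnitalHomOver F M N}
  (c : Conjugator μ)

/-- The conjugated map of algebras `a ↦ v F(a) u`. -/
def conjAlg : A →ₗ[k] B := LinearMap.mulLeftRight k (c.v, c.u) ∘ₗ (F : A →ₗ[k] B)

/-- The conjugated map of bimodules `m ↦ v μ(m) u`. -/
def conjModule : M →ₗ[k] N :=
  Algebra.lsmul k k N c.v ∘ₗ Algebra.lsmul k k N (op c.u) ∘ₗ μ.toLinearMap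

theorem conjAlg_mul (a a' : A) : c.conjAlg (a * a') = c.conjAlg a * c.conjAlg a' := by
  change c.v * F (a * a') * c.u = c.v * F a * c.u * (c.v * F a' * c.u)
  have := congrArg (· * (F a' * c.u)) (c.mul_u_mul_v a)
  simp only [mul_assoc] at this
  simp only [map_mul, mul_assoc, this]

theorem conjAlg_mul_v (a : A) : c.conjAlg a * c.v = c.v * F a := by
  change c.v * F a * c.u * c.v = c.v * F a
  rw [mul_assoc, mul_assoc, ← mul_assoc (F a), c.mul_u_mul_v]

theorem op_conjAlg_smul (a : A) (m : M) : op c.u • μ.toLinearMap (op a • m) =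
    op (c.conjAlg a) • op c.u • μ.toLinearMap m := by
  change _ = op (c.v * F a * c.u) • _
  rw [μ.map_op_smul, op_mul, op_mul, mul_smul, mul_smul, c.op_v_smul]

/-- The tuple `(μ(m) u, v F(r₁) u, …, v F(rⱼ) u, v, F(rⱼ₊₁), …, F(rₙ))`. -/
def homotopyTuple {n : ℕ} (j : Fin (n + 1)) (x : M × (Fin n → A)) : N × (Fin (n + 1) → B) :=
  (op c.u • μ.toLinearMap x.1,
    j.insertNth c.v fun l => if (l : ℕ) < j then c.conjAlg (x.2 l) else F (x.2 l))

/-- The map of chains that takes a pure tensor to the tensor of `homotopyTuple`. -/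
def homotopyTerm {n : ℕ} (j : Fin (n + 1)) : Chains k A M n →ₗ[k] Chains k B N (n + 1) :=
  insertChain j c.v ∘ₗ chainsTensorMap (Algebra.lsmul k k N (op c.u) ∘ₗ μ.toLinearMap)
    fun l => if (l : ℕ) < j then c.conjAlg else (F : A →ₗ[k] B)

theorem homotopyTerm_pureTensor {n : ℕ} (j : Fin (n + 1)) (x : M × (Fin n → A)) :
    c.homotopyTerm j (pureTensor k x) = pureTensor k (c.homotopyTuple j x) := by
  rw [homotopyTerm, LinearMap.comp_apply, chainsTensorMap_pureTensor, insertChain_pureTensor,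
    homotopyTuple]
  dsimp only
  congr with l
  exact apply_ite (fun f : A →ₗ[k] B => f (x.2 l)) _ _ _

theorem homotopyTuple_snd {n : ℕ} (j : Fin (n + 1)) (x : M × (Fin n → A)) (a : Fin (n + 1)) :
    (c.homotopyTuple j x).2 a =
      if h : (a : ℕ) < j then c.conjAlg (x.2 ⟨a, by omega⟩) else
        if h' : (a : ℕ) = j then c.v else F (x.2 ⟨a - 1, by omega⟩) := by
  simp only [homotopyTuple, insertNth_apply_val]
  split_ifs <;> first | rfl | omega

theorem faceTuple_zero_homotopyTuple {n : ℕ} (x : M × (Fin n → A)) :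
    faceTuple 0 (c.homotopyTuple 0 x) = (μ.toLinearMap x.1, fun l => F (x.2 l)) := by
  rw [faceTuple_zero, homotopyTuple, Fin.insertNth_zero', Fin.tail_cons]
  exact Prod.ext (c.op_v_smul _) rfl

theorem faceTuple_last_homotopyTuple {n : ℕ} (x : M × (Fin n → A)) :
    faceTuple (Fin.last (n + 1)) (c.homotopyTuple (Fin.last n) x) =
      (c.conjModule x.1, fun l => c.conjAlg (x.2 l)) := by
  rw [faceTuple_last, homotopyTuple, Fin.insertNth_last', Fin.init_snoc]
  dsimp only
  rw [Fin.snoc_last]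
  exact Prod.ext rfl (funext fun l => if_pos l.2)

theorem faceTuple_homotopyTuple_succ {n : ℕ} (j : Fin n) (x : M × (Fin n → A)) :
    faceTuple j.succ.castSucc (c.homotopyTuple j.succ x) =
      faceTuple j.succ.castSucc (c.homotopyTuple j.castSucc x) := by
  obtain ⟨j, hj⟩ := j
  refine Prod.ext ?_ (funext fun ⟨a, ha⟩ => ?_)
  · simp [faceTuple, homotopyTuple, hj.ne]
  · simp only [faceTuple, homotopyTuple, insertNth_apply_val, Fin.castSucc_mk, Fin.succ_mk]
    split_ifs <;> first | rfl | omega | (subst_vars; exact c.conjAlg_mul_v _)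

theorem faceTuple_castSucc_homotopyTuple_succ {n : ℕ} (i : Fin (n + 2)) (j : Fin (n + 1))
    (h : i ≤ j.castSucc) (x : M × (Fin (n + 1) → A)) :
    faceTuple i.castSucc (c.homotopyTuple j.succ x) = c.homotopyTuple j (faceTuple i x) := by
  obtain ⟨i, hi⟩ := i
  obtain ⟨j, hj⟩ := j
  replace h : i ≤ j := h
  refine Prod.ext ?_ (funext fun ⟨a, ha⟩ => ?_)
  · rcases Nat.eq_zero_or_pos i with rfl | i_pos
    · simp [faceTuple, homotopyTuple, c.op_conjAlg_smul, insertNth_apply_val]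
    · have i_ne_last : i ≠ n + 1 := by omega
      have i_ne_succ_last : i ≠ n + 2 := by omega
      simp [faceTuple, homotopyTuple, i_pos.ne', i_ne_last, i_ne_succ_last]
  · rw [homotopyTuple_snd]
    simp only [faceTuple, homotopyTuple_snd, Fin.castSucc_mk, Fin.succ_mk]
    rcases Nat.eq_zero_or_pos a with rfl | a_pos
    · split_ifs <;> first | rfl | omega | exact (c.conjAlg_mul _ _).symm
    · obtain ⟨a, rfl⟩ := Nat.exists_eq_succ_of_ne_zero a_pos.ne'
      simp only [Nat.succ_eq_add_one, Nat.add_sub_cancel]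
      split_ifs <;> first | rfl | omega | exact (c.conjAlg_mul _ _).symm

theorem faceTuple_succ_homotopyTuple_castSucc {n : ℕ} (i : Fin (n + 2)) (j : Fin (n + 1))
    (h : j.castSucc < i) (x : M × (Fin (n + 1) → A)) :
    faceTuple i.succ (c.homotopyTuple j.castSucc x) = c.homotopyTuple j (faceTuple i x) := by
  obtain ⟨i, hi⟩ := i
  obtain ⟨j, hj⟩ := j
  replace h : j < i := h
  refine Prod.ext ?_ (funext fun ⟨a, ha⟩ => ?_)
  · by_cases i_last : i = n + 1
    · subst i_last
      have face_last (y : M × (Fin (n + 1) → A)) :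
          (faceTuple ⟨n + 1, hi⟩ y).1 = y.2 (Fin.last n) • y.1 :=
        congrArg Prod.fst (faceTuple_last y)
      have snd_last : (c.homotopyTuple (Fin.castSucc ⟨j, hj⟩) x).2 (Fin.last (n + 1)) =
          F (x.2 (Fin.last n)) := by
        rw [homotopyTuple_snd]
        exact (dif_neg (by omega : ¬ n + 1 < j)).trans (dif_neg (by omega : ¬ n + 1 = j))
      calc (faceTuple (Fin.last (n + 2)) (c.homotopyTuple (Fin.castSucc ⟨j, hj⟩) x)).1
        _ = F (x.2 (Fin.last n)) • op c.u • μ.toLinearMap x.1 := by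
          rw [faceTuple_last, snd_last]
          rfl
        _ = op c.u • μ.toLinearMap (x.2 (Fin.last n) • x.1) := by rw [μ.map_smul, smul_comm]
        _ = (c.homotopyTuple ⟨j, hj⟩ (faceTuple ⟨n + 1, hi⟩ x)).1 := by
          rw [← face_last]
          rfl
    · have i_ne_zero : i ≠ 0 := by omega
      simp [faceTuple, homotopyTuple, i_ne_zero, i_last]
  · rw [homotopyTuple_snd]
    simp only [faceTuple, homotopyTuple_snd, Fin.castSucc_mk, Fin.succ_mk]
    rcases Nat.eq_zero_or_pos a with rfl | a_pos
    · split_ifs <;> first | rfl | omega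
    · obtain ⟨a, rfl⟩ := Nat.exists_eq_succ_of_ne_zero a_pos.ne'
      simp only [Nat.succ_eq_add_one, Nat.add_sub_cancel]
      split_ifs <;> first | rfl | omega | exact (map_mul F _ _).symm

variable {n : ℕ}

theorem face_zero_comp_homotopyTerm :
    face k 0 ∘ₗ c.homotopyTerm (0 : Fin (n + 1)) =
      chainsTensorMap μ.toLinearMap fun _ => (F : A →ₗ[k] B) :=
  chains_hom_ext fun x => by
    rw [LinearMap.comp_apply, homotopyTerm_pureTensor, face_pureTensor,
      faceTuple_zero_homotopyTuple, chainsTensorMap_pureTensor]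
    rfl

theorem face_last_comp_homotopyTerm :
    face k (Fin.last (n + 1)) ∘ₗ c.homotopyTerm (Fin.last n) =
      chainsTensorMap c.conjModule fun _ => c.conjAlg :=
  chains_hom_ext fun x => by
    rw [LinearMap.comp_apply, homotopyTerm_pureTensor, face_pureTensor,
      faceTuple_last_homotopyTuple, chainsTensorMap_pureTensor]

theorem face_comp_homotopyTerm_succ (j : Fin n) :
    face k j.succ.castSucc ∘ₗ c.homotopyTerm j.succ =
      face k j.succ.castSucc ∘ₗ c.homotopyTerm j.castSucc :=
  chains_hom_ext fun x => by
    simp only [LinearMap.comp_apply, homotopyTerm_pureTensor, face_pureTensor,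
      faceTuple_homotopyTuple_succ]

theorem face_castSucc_comp_homotopyTerm_succ {i : Fin (n + 2)} {j : Fin (n + 1)}
    (h : i ≤ j.castSucc) :
    face k i.castSucc ∘ₗ c.homotopyTerm j.succ = c.homotopyTerm j ∘ₗ face k i :=
  chains_hom_ext fun x => by
    simp only [LinearMap.comp_apply, homotopyTerm_pureTensor, face_pureTensor,
      c.faceTuple_castSucc_homotopyTuple_succ i j h]

theorem face_succ_comp_homotopyTerm_castSucc {i : Fin (n + 2)} {j : Fin (n + 1)}
    (h : j.castSucc < i) :
    face k i.succ ∘ₗ c.homotopyTerm j.castSucc = c.homotopyTerm j ∘ₗ face k i :=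
  chains_hom_ext fun x => by
    simp only [LinearMap.comp_apply, homotopyTerm_pureTensor, face_pureTensor,
      c.faceTuple_succ_homotopyTuple_castSucc i j h]

/-- The homotopy between the maps of Hochschild chains given by a morphism and its conjugate. -/
def homotopy (n : ℕ) : Chains k A M n →ₗ[k] Chains k B N (n + 1) :=
  ∑ j : Fin (n + 1), (-1 : ℤ) ^ (j : ℕ) • c.homotopyTerm j

theorem hochschildBoundary_comp_homotopy_eq_sum (n : ℕ) :
    hochschildBoundary k B N n ∘ₗ c.homotopy n =
      ∑ j : Fin (n + 1), ∑ i : Fin (n + 2), ((-1 : ℤ) ^ (j : ℕ) * (-1) ^ (i : ℕ)) •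
        (face k i ∘ₗ c.homotopyTerm j) := by
  simp only [hochschildBoundary, homotopy, sum_comp, comp_sum, LinearMap.smul_comp,
    LinearMap.comp_smul, Finset.smul_sum, smul_smul]

theorem homotopy_comp_hochschildBoundary_eq_sum (n : ℕ) :
    c.homotopy n ∘ₗ hochschildBoundary k A M n =
      ∑ i : Fin (n + 2), ∑ j : Fin (n + 1), ((-1 : ℤ) ^ (j : ℕ) * (-1) ^ (i : ℕ)) •
        (c.homotopyTerm j ∘ₗ face k i) := by
  simp only [hochschildBoundary, homotopy, sum_comp, comp_sum, LinearMap.smul_comp,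
    LinearMap.comp_smul, Finset.smul_sum, smul_smul, mul_comm]

/-- The family `E` stands for the composites `homotopyTerm j ∘ face i`, which make no sense when
`n = 0`. -/
theorem hochschildBoundary_comp_homotopy_of_face_comp_eq
    (E : Fin n → Fin (n + 1) → Chains k A M n →ₗ[k] Chains k B N n)
    (hE : ∀ i j, i ≤ j.castSucc → face k i.castSucc ∘ₗ c.homotopyTerm j.succ = E j i)
    (hE' : ∀ i j, j.castSucc < i → face k i.succ ∘ₗ c.homotopyTerm j.castSucc = E j i) :
    hochschildBoundary k B N n ∘ₗ c.homotopy n =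
      chainsTensorMap μ.toLinearMap (fun _ => (F : A →ₗ[k] B)) -
          chainsTensorMap c.conjModule (fun _ => c.conjAlg) -
        ∑ i : Fin (n + 1), ∑ j : Fin n, ((-1 : ℤ) ^ (j : ℕ) * (-1) ^ (i : ℕ)) • E j i := by
  let K : Fin (n + 2) → Chains k A M n →ₗ[k] Chains k B N n :=
    Fin.snoc (fun j => face k j.castSucc ∘ₗ c.homotopyTerm j)
      (chainsTensorMap c.conjModule fun _ => c.conjAlg)
  have hK (j : Fin (n + 1)) : K j.castSucc = face k j.castSucc ∘ₗ c.homotopyTerm j :=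
    Fin.snoc_castSucc (α := fun _ => _) _ _ j
  have hK_last : K (Fin.last _) = chainsTensorMap c.conjModule fun _ => c.conjAlg :=
    Fin.snoc_last (α := fun _ => _) _ _
  have hK_succ (j : Fin (n + 1)) : face k j.succ ∘ₗ c.homotopyTerm j = K j.succ := by
    induction j using Fin.lastCases with
    | last => rw [Fin.succ_last, hK_last, face_last_comp_homotopyTerm]
    | cast j => rw [Fin.succ_castSucc, hK, face_comp_homotopyTerm_succ]
  rw [hochschildBoundary_comp_homotopy_eq_sum,
    alternating_sum_of_presimplicial_homotopy (fun i j => face k i ∘ₗ c.homotopyTerm j) E K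
      (fun j => (hK j).symm) hK_succ hE hE',
    hK_last, ← Fin.castSucc_zero, hK, Fin.castSucc_zero, face_zero_comp_homotopyTerm]

theorem hochschildBoundary_comp_homotopy_zero :
    hochschildBoundary k B N 0 ∘ₗ c.homotopy 0 =
      chainsTensorMap μ.toLinearMap (fun _ => (F : A →ₗ[k] B)) -
        chainsTensorMap c.conjModule (fun _ => c.conjAlg) := by
  rw [c.hochschildBoundary_comp_homotopy_of_face_comp_eq (fun j => j.elim0)
      (fun _ j => j.elim0) fun _ j => j.elim0]
  simp

theorem hochschildBoundary_comp_homotopy_succ (n : ℕ) :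
    hochschildBoundary k B N (n + 1) ∘ₗ c.homotopy (n + 1) =
      chainsTensorMap μ.toLinearMap (fun _ => (F : A →ₗ[k] B)) -
          chainsTensorMap c.conjModule (fun _ => c.conjAlg) -
        c.homotopy n ∘ₗ hochschildBoundary k A M n := by
  rw [c.hochschildBoundary_comp_homotopy_of_face_comp_eq (fun j i => c.homotopyTerm j ∘ₗ face k i)
      (fun _ _ => c.face_castSucc_comp_homotopyTerm_succ)
      fun _ _ => c.face_succ_comp_homotopyTerm_castSucc,
    homotopy_comp_hochschildBoundary_eq_sum]

end Conjugator

end Conjugator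

section Conjugation

variable {A : Type u} [Ring A] [Algebra k A] {ι : Type} [Fintype ι] {a b a' b' : ι → A}

theorem sum_mul_mul_mul (h : ∑ i, a i * b i = 1) (x y : A) :
    ∑ i, x * a i * (b i * y) = x * y := by
  simp only [mul_assoc x, ← mul_assoc (a _), ← Finset.mul_sum, ← Finset.sum_mul, h, one_mul]

theorem sum_mul_smul_smul {M : Type u} [AddCommGroup M] [Module A M] (h : ∑ i, a i * b i = 1)
    (x : A) (m : M) : ∑ i, (x * a i) • b i • m = x • m := by
  simp only [smul_smul, mul_assoc, ← Finset.sum_smul, ← Finset.mul_sum, h, mul_one]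

theorem sum_op_mul_smul_smul {M : Type u} [AddCommGroup M] [Module Aᵐᵒᵖ M]
    (h : ∑ i, a i * b i = 1) (x : A) (m : M) : ∑ i, op (b i * x) • op (a i) • m = op x • m := by
  simp only [smul_smul, ← op_mul, ← mul_assoc, ← Finset.sum_smul, ← Finset.op_sum,
    ← Finset.sum_mul, h, one_mul]

/-- The morphism `x ↦ (bᵢ x aⱼ)` of algebras given by elements with `∑ aᵢ bᵢ = 1`. -/
def conjAlgHom (h : ∑ i, a i * b i = 1) : MatAlgHom k A A ι :=
  MatAlgHom.ofEntries (fun i j => LinearMap.mulLeftRight k (b i, a j)) fun i j x y => by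
    simp only [LinearMap.mulLeftRight_apply]
    rw [← mul_assoc, mul_assoc _ y, ← sum_mul_mul_mul h]
    simp only [mul_assoc]

theorem conjAlgHom_apply (h : ∑ i, a i * b i = 1) (x : A) (i j : ι) :
    conjAlgHom (k := k) h x i j = b i * x * a j :=
  rfl

theorem sum_option_elim (h : ∑ i, a i * b i = 1) :
    ∑ i : Option ι, i.elim 0 a * i.elim 0 b = 1 := by
  rw [Fintype.sum_option]
  simp [h]

variable [DecidableEq ι] (M : Bimodule k A A)

/-- The morphism `m ↦ (bᵢ m aⱼ)` of bimodules given by elements with `∑ aᵢ bᵢ = 1`. -/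
def conjHom (h : ∑ i, a i * b i = 1) : MatHom M M (conjAlgHom h) :=
  MatHom.ofEntries _ (fun i j => Algebra.lsmul k k M (b i) ∘ₗ Algebra.lsmul k k M (op (a j)))
    (fun i j x m => by
      change b i • op (a j) • x • m = ∑ l, (b i * x * a l) • b l • op (a j) • m
      rw [sum_mul_smul_smul h, ← smul_comm x, smul_smul])
    (fun i j x m => by
      change b i • op (a j) • op x • m = ∑ l, op (b l * x * a j) • b i • op (a l) • m
      simp only [← smul_comm (b i), mul_assoc]
      rw [← Finset.smul_sum, sum_op_mul_smul_smul h, smul_smul (op (a j)), ← op_mul])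

/-- The conjugation relating two decompositions `∑ aᵢ bᵢ = 1 = ∑ a'ᵢ b'ᵢ`. -/
def conjugator (h : ∑ i, a i * b i = 1) (h' : ∑ i, a' i * b' i = 1) :
    Conjugator (conjHom M h) where
  u := Matrix.vecMulVec b a'
  v := Matrix.vecMulVec b' a
  mul_u_mul_v x := by
    rw [mul_assoc, Matrix.vecMulVec_mul_vecMulVec]
    ext i j
    simp only [Matrix.mul_apply, Matrix.vecMulVec_apply, dotProduct, h', one_smul,
      conjAlgHom_apply, sum_mul_mul_mul h]
  op_v_smul m := by
    rw [smul_smul, ← op_mul, Matrix.vecMulVec_mul_vecMulVec]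
    refine Bimodule.matrix_ext fun i j => ?_
    rw [Bimodule.matrixEntry_op_smul]
    simp only [Matrix.vecMulVec_apply, dotProduct, h', one_smul]
    change ∑ l, op (b l * a j) • b i • op (a l) • m = b i • op (a j) • m
    simp only [← smul_comm (b i), ← Finset.smul_sum, sum_op_mul_smul_smul h]

theorem conjugator_conjAlg (h : ∑ i, a i * b i = 1) (h' : ∑ i, a' i * b' i = 1) :
    (conjugator M h h').conjAlg =
      ((conjAlgHom h' : MatAlgHom k A A ι) : A →ₗ[k] Matrix ι ι A) := by
  ext x i j
  change (Matrix.vecMulVec b' a * conjAlgHom (k := k) h x * Matrix.vecMulVec b a') i j =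
    b' i * x * a' j
  simp only [Matrix.mul_apply, Matrix.vecMulVec_apply, conjAlgHom_apply, mul_assoc (b _),
    sum_mul_mul_mul h]
  simp only [← mul_assoc (b' i), sum_mul_mul_mul h]

theorem conjugator_conjModule (h : ∑ i, a i * b i = 1) (h' : ∑ i, a' i * b' i = 1) :
    (conjugator M h h').conjModule = (conjHom M h').toLinearMap := by
  refine LinearMap.ext fun m => Bimodule.matrix_ext fun i j => ?_
  refine (Bimodule.matrixEntry_smul i j (Matrix.vecMulVec b' a) _).trans ?_
  simp only [Matrix.vecMulVec_apply]
  change ∑ r, (b' i * a r) • ∑ s, op (b s * a' j) • b r • op (a s) • m = b' i • op (a' j) • m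
  simp only [← smul_comm (b _), ← Finset.smul_sum, sum_op_mul_smul_smul h, sum_mul_smul_smul h]

variable (A) in
theorem sum_single_mul_single (i₀ : ι) :
    ∑ i, (Pi.single i₀ 1 : ι → A) i * (Pi.single i₀ 1 : ι → A) i = 1 := by
  simp [Pi.single_apply]

theorem traceMap_conj_single (i₀ : ι) (n : ℕ) :
    traceMap (conjAlgHom (sum_single_mul_single A i₀)).entry
      (conjHom M (sum_single_mul_single A i₀)).entry n = LinearMap.id := by
  have alg (i j : ι) (x : A) : (conjAlgHom (k := k) (sum_single_mul_single A i₀)).entry i j x =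
      (Pi.single i₀ 1 : ι → A) i * x * (Pi.single i₀ 1 : ι → A) j := rfl
  have mod (i j : ι) (m : M) : (conjHom M (sum_single_mul_single A i₀)).entry i j m =
      (Pi.single i₀ 1 : ι → A) i • op ((Pi.single i₀ 1 : ι → A) j) • m := rfl
  have ne {i : ι} (hi : i ∉ Set.range fun _ : Unit => i₀) : i ≠ i₀ := fun h => hi ⟨(), h.symm⟩
  refine chains_hom_ext fun x => ?_
  rw [traceMap_eq_of_injective (f := fun _ _ : Unit => LinearMap.id)
      (g := fun _ _ : Unit => LinearMap.id) (fun _ => i₀) (Function.injective_of_subsingleton _)]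
  · exact traceMap_of_unique _ _ x
  · exact fun _ _ => LinearMap.ext fun x => by simp [alg]
  · exact fun _ _ => LinearMap.ext fun x => by simp [mod]
  · exact fun i j hi => LinearMap.ext fun x => by simp [alg, ne hi]
  · exact fun i j hi => LinearMap.ext fun x => by simp [mod, ne hi]

theorem traceMap_conj_option_elim (h : ∑ i, a i * b i = 1) (n : ℕ) :
    traceMap (conjAlgHom (sum_option_elim h)).entry (conjHom M (sum_option_elim h)).entry n =
      traceMap (conjAlgHom h).entry (conjHom M h).entry n := by
  have eq_none {i : Option ι} (hi : i ∉ Set.range some) : i = none :=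
    Option.eq_none_iff_forall_some_ne.2 fun j hj => hi ⟨j, hj⟩
  refine traceMap_eq_of_injective some (Option.some_injective ι) (fun _ _ => rfl) (fun _ _ => rfl)
    (fun i j hi => ?_) (fun i j hi => ?_) n
  · rw [eq_none hi]
    exact LinearMap.ext fun x => mul_zero _
  · rw [eq_none hi]
    refine LinearMap.ext fun m => ?_
    change (_ : A) • op (0 : A) • m = 0
    rw [op_zero, zero_smul, smul_zero]

/-- The homotopy between the generalized traces of two conjugations `x ↦ (bᵢ x aⱼ)` and
`x ↦ (b'ᵢ x a'ⱼ)`. -/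
def conjHomotopy (h : ∑ i, a i * b i = 1) (h' : ∑ i, a' i * b' i = 1) (n : ℕ) :
    Chains k A M n →ₗ[k] Chains k A M (n + 1) :=
  traceMap (MatAlgHom.entry (NonUnitalAlgHom.id k (Matrix ι ι A)))
      (MatHom.entry (NonUnitalHomOver.id (M.matrix ι))) (n + 1) ∘ₗ (conjugator M h h').homotopy n

theorem hochschildBoundary_comp_conjHomotopy_zero (h : ∑ i, a i * b i = 1)
    (h' : ∑ i, a' i * b' i = 1) :
    hochschildBoundary k A M 0 ∘ₗ conjHomotopy M h h' 0 =
      traceMap (conjAlgHom h).entry (conjHom M h).entry 0 -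
        traceMap (conjAlgHom h').entry (conjHom M h').entry 0 := by
  rw [conjHomotopy, ← LinearMap.comp_assoc, hochschildBoundary_comp_traceMap, LinearMap.comp_assoc,
    Conjugator.hochschildBoundary_comp_homotopy_zero, LinearMap.comp_sub,
    traceMap_comp_chainsTensorMap, traceMap_comp_chainsTensorMap, conjugator_conjAlg,
    conjugator_conjModule]
  rfl

theorem hochschildBoundary_comp_conjHomotopy_succ (h : ∑ i, a i * b i = 1)
    (h' : ∑ i, a' i * b' i = 1) (n : ℕ) :
    hochschildBoundary k A M (n + 1) ∘ₗ conjHomotopy M h h' (n + 1) =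
      traceMap (conjAlgHom h).entry (conjHom M h).entry (n + 1) -
          traceMap (conjAlgHom h').entry (conjHom M h').entry (n + 1) -
        conjHomotopy M h h' n ∘ₗ hochschildBoundary k A M n := by
  rw [conjHomotopy, ← LinearMap.comp_assoc, hochschildBoundary_comp_traceMap, LinearMap.comp_assoc,
    Conjugator.hochschildBoundary_comp_homotopy_succ, LinearMap.comp_sub, LinearMap.comp_sub,
    traceMap_comp_chainsTensorMap, traceMap_comp_chainsTensorMap, conjugator_conjAlg,
    conjugator_conjModule, ← LinearMap.comp_assoc]
  rfl

theorem exists_homotopy_id_conj (h : ∑ i, a i * b i = 1) :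
    ∃ s : ∀ n, Chains k A M n →ₗ[k] Chains k A M (n + 1),
      hochschildBoundary k A M 0 ∘ₗ s 0 =
          LinearMap.id - traceMap (conjAlgHom h).entry (conjHom M h).entry 0 ∧
        ∀ n, hochschildBoundary k A M (n + 1) ∘ₗ s (n + 1) =
          LinearMap.id - traceMap (conjAlgHom h).entry (conjHom M h).entry (n + 1) -
            s n ∘ₗ hochschildBoundary k A M n := by
  have base := sum_single_mul_single A (none : Option ι)
  refine ⟨conjHomotopy M base (sum_option_elim h), ?_, fun n => ?_⟩
  · rw [hochschildBoundary_comp_conjHomotopy_zero, traceMap_conj_single,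
      traceMap_conj_option_elim]
  · rw [hochschildBoundary_comp_conjHomotopy_succ, traceMap_conj_single,
      traceMap_conj_option_elim]

end Conjugation

/-! ### Chain maps given by generalized traces -/

section CyclicTrace

variable {A B : Type u} [Ring A] [Ring B] [Algebra k A] [Algebra k B] {ι : Type} [Fintype ι]

theorem rot_comp_traceMap (f : ι → ι → A →ₗ[k] B) (n : ℕ) :
    rot k B n ∘ₗ traceMap f f n = traceMap f f n ∘ₗ rot k A n :=
  chains_hom_ext fun x => by
    simp only [LinearMap.comp_apply, traceMap_pureTensor, map_sum, rot_pureTensor]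
    cases n with
    | zero => rfl
    | succ n =>
      rw [← ((finRotate (n + 2)).symm.arrowCongr (Equiv.refl ι)).sum_comp]
      refine Finset.sum_congr rfl fun I _ => congrArg _ (Prod.ext ?_ (funext fun j => ?_))
      · simp [traceTuple, rotTuple]
      · refine Fin.cases ?_ (fun j => ?_) j
        · simp [traceTuple, rotTuple]
        · simp only [traceTuple, rotTuple, Equiv.arrowCongr_apply, Equiv.coe_refl,
            Equiv.symm_symm, Function.comp_apply, finRotate_apply, id_eq, Fin.coeSucc_eq_succ,
            Fin.cons_succ, Fin.succ_castSucc]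

theorem cyclicOp_comp_traceMap (f : ι → ι → A →ₗ[k] B) (n : ℕ) :
    cyclicOp k B n ∘ₗ traceMap f f n = traceMap f f n ∘ₗ cyclicOp k A n := by
  simp only [cyclicOp, LinearMap.smul_comp, LinearMap.comp_smul, rot_comp_traceMap]

theorem normOp_comp_traceMap (f : ι → ι → A →ₗ[k] B) (n : ℕ) :
    normOp k B n ∘ₗ traceMap f f n = traceMap f f n ∘ₗ normOp k A n := by
  have pow_comp (j : ℕ) : (cyclicOp k B n ^ j) ∘ₗ traceMap f f n =
      traceMap f f n ∘ₗ (cyclicOp k A n ^ j) :=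
    Module.End.commute_pow_left_of_commute (cyclicOp_comp_traceMap f n) j
  simp only [normOp, sum_comp, comp_sum, pow_comp]

theorem horizontal_comp_traceMap (f : ι → ι → A →ₗ[k] B) (p n : ℕ) :
    horizontal k B p n ∘ₗ traceMap f f n = traceMap f f n ∘ₗ horizontal k A p n := by
  unfold horizontal
  split_ifs
  · exact normOp_comp_traceMap f n
  · rw [LinearMap.sub_comp, LinearMap.comp_sub, cyclicOp_comp_traceMap]
    rfl

theorem vertical_comp_traceMap (F : MatAlgHom k A B ι) (p n : ℕ) :
    vertical k B p n ∘ₗ traceMap F.entry F.entry (n + 1) =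
      traceMap F.entry F.entry n ∘ₗ vertical k A p n := by
  classical
  unfold vertical
  split_ifs
  · exact hochschildBoundary_comp_traceMap (MatHom.self F) n
  · rw [LinearMap.neg_comp, LinearMap.comp_neg]
    exact congrArg _ (barBoundary_comp_traceMap (MatHom.self F) n)

/-- The map of total modules of the cyclic bicomplexes given by the generalized trace in each
bidegree. -/
def cyclicTotalTrace (f : ι → ι → A →ₗ[k] B) (n : ℕ) : CyclicTotal k A n →ₗ[k] CyclicTotal k B n :=
  LinearMap.pi fun q => traceMap f f q ∘ₗ
    LinearMap.proj (φ := fun i : Fin (n + 1) => Chains k A A (i : ℕ)) q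

theorem cyclicBoundary_comp_cyclicTotalTrace (F : MatAlgHom k A B ι) (n : ℕ) :
    cyclicBoundary k B n ∘ₗ cyclicTotalTrace F.entry (n + 1) =
      cyclicTotalTrace F.entry n ∘ₗ cyclicBoundary k A n := by
  refine LinearMap.ext fun x => funext fun q => ?_
  have vert := LinearMap.congr_fun (vertical_comp_traceMap F (n - q) q) (x q.succ)
  have horiz :=
    LinearMap.congr_fun (horizontal_comp_traceMap F.entry (n + 1 - q) q) (x q.castSucc)
  exact (congrArg₂ (· + ·) vert horiz).trans (map_add (traceMap F.entry F.entry q) _ _).symm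

end CyclicTrace

section Complexes

variable {A B C : Type u} [Ring A] [Ring B] [Ring C] [Algebra k A] [Algebra k B] [Algebra k C]
  {ι κ ν : Type} [Fintype ι] [Fintype κ] [Fintype ν]

theorem hochschildComplex_d (M : Bimodule k A A) (n : ℕ) :
    (hochschildComplex M).d (n + 1) n = ModuleCat.ofHom (hochschildBoundary k A M n) := by
  simp only [hochschildComplex, ChainComplex.of_d]

variable (k A) in
theorem cyclicComplex_d (n : ℕ) :
    (cyclicComplex k A).d (n + 1) n = ModuleCat.ofHom (cyclicBoundary k A n) := by
  simp only [cyclicComplex, ChainComplex.of_d]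

/-- The chain map of Hochschild complexes given by the generalized trace. -/
def hochschildTrace [DecidableEq ι] {F : MatAlgHom k A B ι} {M : Bimodule k A A}
    {N : Bimodule k B B} (μ : MatHom M N F) : hochschildComplex M ⟶ hochschildComplex N :=
  ChainComplex.ofHom (fun n => ModuleCat.ofHom (traceMap F.entry μ.entry n)) fun n => by
    rw [hochschildComplex_d, hochschildComplex_d]
    exact congrArg ModuleCat.ofHom (hochschildBoundary_comp_traceMap μ n)

/-- The chain map of cyclic complexes given by the generalized trace. -/
def cyclicTrace (F : MatAlgHom k A B ι) : cyclicComplex k A ⟶ cyclicComplex k B :=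
  ChainComplex.ofHom (fun n => ModuleCat.ofHom (cyclicTotalTrace F.entry n)) fun n => by
    rw [cyclicComplex_d, cyclicComplex_d]
    exact congrArg ModuleCat.ofHom (cyclicBoundary_comp_cyclicTotalTrace F n)

theorem cyclicTrace_congr {F : MatAlgHom k A B ι} {G : MatAlgHom k A B κ}
    (h : ∀ n, traceMap F.entry F.entry n = traceMap G.entry G.entry n) :
    cyclicTrace F = cyclicTrace G :=
  HomologicalComplex.hom_ext _ _ fun _ => ModuleCat.hom_ext <| LinearMap.ext fun x =>
    funext fun q => LinearMap.congr_fun (h q) (x q)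

theorem cyclicTrace_eq_id {F : MatAlgHom k A A ι}
    (h : ∀ n, traceMap F.entry F.entry n = LinearMap.id) : cyclicTrace F = 𝟙 (cyclicComplex k A) :=
  HomologicalComplex.hom_ext _ _ fun _ => ModuleCat.hom_ext <| LinearMap.ext fun x =>
    funext fun q => LinearMap.congr_fun (h q) (x q)

theorem cyclicTrace_comp {F : MatAlgHom k A B ι} {G : MatAlgHom k B C κ} {H : MatAlgHom k A C ν}
    (h : ∀ n, traceMap G.entry G.entry n ∘ₗ traceMap F.entry F.entry n =
      traceMap H.entry H.entry n) : cyclicTrace F ≫ cyclicTrace G = cyclicTrace H :=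
  HomologicalComplex.hom_ext _ _ fun _ => ModuleCat.hom_ext <| LinearMap.ext fun x =>
    funext fun q => LinearMap.congr_fun (h q) (x q)

theorem hochschildTrace_comp [DecidableEq ι] [DecidableEq κ] [DecidableEq ν]
    {F : MatAlgHom k A B ι} {G : MatAlgHom k B C κ} {H : MatAlgHom k A C ν} {M : Bimodule k A A}
    {N : Bimodule k B B} {L : Bimodule k C C} {μ : MatHom M N F} {ξ : MatHom N L G}
    {ρ : MatHom M L H} (h : ∀ n, traceMap G.entry ξ.entry n ∘ₗ traceMap F.entry μ.entry n =
      traceMap H.entry ρ.entry n) :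
    hochschildTrace μ ≫ hochschildTrace ξ = hochschildTrace ρ :=
  HomologicalComplex.hom_ext _ _ fun n => ModuleCat.hom_ext (h n)

end Complexes

section NullHomotopic

variable {𝓐 : Type*} [Category* 𝓐] [Preadditive 𝓐] {K L : ChainComplex 𝓐 ℕ}

/-- The chain map `d s + s d` given by morphisms `s n` of degree one. -/
def nullHomotopicHom (s : ∀ n, K.X n ⟶ L.X (n + 1)) : K ⟶ L :=
  Homotopy.nullHomotopicMap' fun i _ hij => s i ≫ eqToHom (congrArg L.X hij)

theorem nullHomotopicHom_f_zero (s : ∀ n, K.X n ⟶ L.X (n + 1)) :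
    (nullHomotopicHom s).f 0 = s 0 ≫ L.d 1 0 := by
  rw [nullHomotopicHom, Homotopy.nullHomotopicMap'_f_of_not_rel_left (k₁ := 1) (k₀ := 0) rfl
    (by simp), eqToHom_refl, Category.comp_id]

theorem nullHomotopicHom_f_succ (s : ∀ n, K.X n ⟶ L.X (n + 1)) (n : ℕ) :
    (nullHomotopicHom s).f (n + 1) = K.d (n + 1) n ≫ s n + s (n + 1) ≫ L.d (n + 2) (n + 1) := by
  rw [nullHomotopicHom, Homotopy.nullHomotopicMap'_f (k₂ := n + 2) (k₀ := n) rfl rfl, eqToHom_refl,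
    eqToHom_refl, Category.comp_id, Category.comp_id]

theorem homologyMap_nullHomotopicHom [CategoryWithHomology 𝓐] (s : ∀ n, K.X n ⟶ L.X (n + 1))
    (n : ℕ) : HomologicalComplex.homologyMap (nullHomotopicHom s) n = 0 := by
  rw [nullHomotopicHom, (Homotopy.nullHomotopy' _).homologyMap_eq,
    HomologicalComplex.homologyMap_zero]

end NullHomotopic

theorem homologyMap_hochschildTrace_conjHom {A : Type u} [Ring A] [Algebra k A] {ι : Type}
    [Fintype ι] [DecidableEq ι] {a b : ι → A} (h : ∑ i, a i * b i = 1) (M : Bimodule k A A)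
    (n : ℕ) : HomologicalComplex.homologyMap (hochschildTrace (conjHom M h)) n =
      𝟙 ((hochschildComplex M).homology n) := by
  obtain ⟨s, hs₀, hs⟩ := exists_homotopy_id_conj M h
  let H (n : ℕ) : (hochschildComplex M).X n ⟶ (hochschildComplex M).X (n + 1) :=
    ModuleCat.ofHom (s n)
  have homotopy : 𝟙 _ - hochschildTrace (conjHom M h) = nullHomotopicHom H := by
    refine HomologicalComplex.hom_ext _ _ fun n => ?_
    cases n with
    | zero =>
      rw [nullHomotopicHom_f_zero, hochschildComplex_d]
      exact congrArg ModuleCat.ofHom hs₀.symm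
    | succ n =>
      rw [nullHomotopicHom_f_succ, hochschildComplex_d, hochschildComplex_d]
      exact congrArg ModuleCat.ofHom (eq_add_of_sub_eq' (hs n).symm)
  rw [← HomologicalComplex.homologyMap_id, eq_comm, ← sub_eq_zero,
    ← HomologicalComplex.homologyMap_sub, homotopy, homologyMap_nullHomotopicHom]

/-! ### Conjugations and cyclic homology -/

section BarContraction

variable (k) (A : Type u) [Ring A] [Algebra k A]

/-- The contraction `r₀ ⊗ ⋯ ⊗ rₙ ↦ 1 ⊗ r₀ ⊗ ⋯ ⊗ rₙ` of the bar complex. -/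
def barContraction (n : ℕ) : Chains k A A n →ₗ[k] Chains k A A (n + 1) :=
  rot k A (n + 1) ∘ₗ insertChain (Fin.last n) 1

variable {A}

theorem barContraction_pureTensor {n : ℕ} (x : A × (Fin n → A)) :
    barContraction k A n (pureTensor k x) = pureTensor k (1, Fin.cons x.1 x.2) := by
  rw [barContraction, LinearMap.comp_apply, insertChain_pureTensor, rot_pureTensor]
  simp [rotTuple]

theorem face_zero_comp_barContraction (n : ℕ) :
    face k 0 ∘ₗ barContraction k A n = LinearMap.id :=
  chains_hom_ext fun x => by
    simp [barContraction_pureTensor, face_pureTensor, faceTuple]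

theorem face_succ_comp_barContraction {n : ℕ} (i : Fin (n + 1)) :
    face k i.succ.castSucc ∘ₗ barContraction k A (n + 1) =
      barContraction k A n ∘ₗ face k i.castSucc :=
  chains_hom_ext fun x => by
    simp only [LinearMap.comp_apply, barContraction_pureTensor, face_pureTensor]
    obtain ⟨i, hi⟩ := i
    refine congrArg _ (Prod.ext ?_ (funext fun a => ?_))
    · simp [faceTuple, show i ≠ n + 1 by omega]
    · refine Fin.cases ?_ (fun a => ?_) a
      · rcases Nat.eq_zero_or_pos i with rfl | hi₀
        · simp [faceTuple]
        · simp [faceTuple, hi₀, hi₀.ne', show i ≠ n + 1 by omega]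
      · simp only [faceTuple, Fin.val_succ, Fin.cons_succ, Fin.castSucc_mk,
          Fin.succ_mk, ← Fin.succ_castSucc, Nat.add_lt_add_iff_right, Nat.add_right_cancel_iff]

variable (A)

theorem barBoundary_comp_barContraction_zero :
    barBoundary k A A 0 ∘ₗ barContraction k A 0 = LinearMap.id := by
  rw [barBoundary, Fin.sum_univ_one]
  simpa using face_zero_comp_barContraction k (A := A) 0

theorem barBoundary_comp_barContraction (n : ℕ) :
    barBoundary k A A (n + 1) ∘ₗ barContraction k A (n + 1) =
      LinearMap.id - barContraction k A n ∘ₗ barBoundary k A A n := by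
  rw [barBoundary, barBoundary, Fin.sum_univ_succ, LinearMap.add_comp, sum_comp, comp_sum,
    sub_eq_add_neg, ← Finset.sum_neg_distrib]
  congr 1
  · simpa using face_zero_comp_barContraction k (A := A) (n + 1)
  · refine Finset.sum_congr rfl fun i _ => ?_
    rw [LinearMap.smul_comp, face_succ_comp_barContraction, LinearMap.comp_smul, Fin.val_succ,
      pow_succ, mul_neg_one, neg_smul]

end BarContraction

section RowFiltration

variable {A : Type u} [Ring A] [Algebra k A]

variable (k A) in
/-- The submodule of the total module of the cyclic bicomplex of the elements whose components in
the rows `q < c` vanish. -/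
def rowsGE (n c : ℕ) : Submodule k (CyclicTotal k A n) :=
  Submodule.pi {q | (q : ℕ) < c} fun _ => ⊥

variable {ι : Type} [Fintype ι] {F : MatAlgHom k A A ι}

variable (F) in
/-- A homotopy in each column of the cyclic bicomplex from the generalized trace to the identity;
no compatibility with the horizontal differential is required. -/
structure ColumnHomotopy where
  /-- The component of the homotopy in column `p` and row `q`. -/
  hom (p q : ℕ) : Chains k A A q →ₗ[k] Chains k A A (q + 1)
  vertical_comp_zero (p : ℕ) :
    vertical k A p 0 ∘ₗ hom p 0 = LinearMap.id - traceMap F.entry F.entry 0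
  vertical_comp_succ (p n : ℕ) : vertical k A p (n + 1) ∘ₗ hom p (n + 1) =
    LinearMap.id - traceMap F.entry F.entry (n + 1) - hom p n ∘ₗ vertical k A p n

namespace ColumnHomotopy

variable (s : ColumnHomotopy F)

/-- The map of degree one on the total modules of the cyclic bicomplex. -/
def total (n : ℕ) : CyclicTotal k A n →ₗ[k] CyclicTotal k A (n + 1) :=
  LinearMap.pi <| Fin.cases (motive := fun q => _ →ₗ[k] Chains k A A (q : ℕ)) 0 fun q =>
    s.hom (n - q) q ∘ₗ LinearMap.proj (φ := fun i : Fin (n + 1) => Chains k A A (i : ℕ)) q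

theorem vertical_hom_zero (p : ℕ) (y : Chains k A A 0) :
    vertical k A p 0 (s.hom p 0 y) = y - traceMap F.entry F.entry 0 y :=
  LinearMap.congr_fun (s.vertical_comp_zero p) y

theorem vertical_hom_succ (p n : ℕ) (y : Chains k A A (n + 1)) :
    vertical k A p (n + 1) (s.hom p (n + 1) y) =
      y - traceMap F.entry F.entry (n + 1) y - s.hom p n (vertical k A p n y) :=
  LinearMap.congr_fun (s.vertical_comp_succ p n) y

theorem cyclicBoundary_total_apply_zero (n : ℕ) (x : CyclicTotal k A n) :
    cyclicBoundary k A n (s.total n x) 0 = vertical k A n 0 (s.hom n 0 (x 0)) :=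
  (congrArg _ (map_zero (horizontal k A (n + 1) 0))).trans (add_zero _)

theorem cyclicBoundary_total_apply_succ (n : ℕ) {x : CyclicTotal k A (n + 1)} {q : Fin (n + 1)}
    (hq : x q.castSucc = 0) :
    cyclicBoundary k A (n + 1) (s.total (n + 1) x) q.succ =
      vertical k A (n - q) (q + 1) (s.hom (n - q) (q + 1) (x q.succ)) := by
  have horiz : horizontal k A (n + 2 - (q + 1)) (q + 1) (s.hom (n + 1 - q) q (x q.castSucc)) = 0 :=
    (congrArg _ ((congrArg (s.hom _ q) hq).trans (map_zero _))).trans (map_zero _)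
  rw [← Nat.add_sub_add_right n 1 q]
  exact (congrArg _ horiz).trans (add_zero _)

theorem total_cyclicBoundary_apply_succ (n : ℕ) {x : CyclicTotal k A (n + 1)} {q : Fin (n + 1)}
    (hq : x q.castSucc = 0) :
    s.total n (cyclicBoundary k A n x) q.succ =
      s.hom (n - q) q (vertical k A (n - q) q (x q.succ)) := by
  have horiz : horizontal k A (n + 1 - q) q (x q.castSucc) = 0 :=
    (congrArg (horizontal k A _ q) hq).trans (map_zero _)
  have boundary : cyclicBoundary k A n x q = vertical k A (n - q) q (x q.succ) :=
    (congrArg _ horiz).trans (add_zero _)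
  exact congrArg (s.hom (n - q) q) boundary

variable {c : ℕ}

theorem sub_trace_sub_total_mem_rowsGE_zero (x : CyclicTotal k A 0) :
    x - cyclicTotalTrace F.entry 0 x - cyclicBoundary k A 0 (s.total 0 x) ∈ rowsGE k A 0 c := by
  intro q _
  obtain rfl := Subsingleton.elim (α := Fin 1) 0 q
  exact sub_eq_zero.2 ((s.cyclicBoundary_total_apply_zero 0 x).trans (s.vertical_hom_zero 0 _)).symm

theorem sub_trace_sub_total_mem_rowsGE_succ {n : ℕ} {x : CyclicTotal k A (n + 1)}
    (hx : x ∈ rowsGE k A (n + 1) c) :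
    x - cyclicTotalTrace F.entry (n + 1) x - (s.total n (cyclicBoundary k A n x) +
      cyclicBoundary k A (n + 1) (s.total (n + 1) x)) ∈ rowsGE k A (n + 1) (c + 1) := by
  intro q
  refine Fin.cases (fun _ => ?_) (fun q hq => ?_) q
  · have boundary := (s.cyclicBoundary_total_apply_zero (n + 1) x).trans (s.vertical_hom_zero _ _)
    exact sub_eq_zero.2 ((zero_add _).trans boundary).symm
  · have prev := hx q.castSucc (Nat.lt_of_succ_lt_succ hq)
    have boundary := (s.cyclicBoundary_total_apply_succ n prev).trans (s.vertical_hom_succ _ _ _)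
    refine sub_eq_zero.2 (Eq.symm ?_)
    exact (congrArg₂ (· + ·) (s.total_cyclicBoundary_apply_succ n prev) boundary).trans
      (add_sub_cancel _ _)

/-- The chain map `1 - tr - (d s + s d)`, where `tr` is the generalized trace and `s` the total
map of the homotopy in the columns. -/
def defect : End (cyclicComplex k A) :=
  𝟙 _ - cyclicTrace F - nullHomotopicHom fun n => ModuleCat.ofHom (s.total n)

theorem defect_f_mem_rowsGE {n : ℕ} {x : CyclicTotal k A n} (hx : x ∈ rowsGE k A n c) :
    s.defect.f n x ∈ rowsGE k A n (c + 1) := by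
  rw [defect, HomologicalComplex.sub_f_apply]
  cases n with
  | zero =>
    rw [nullHomotopicHom_f_zero, cyclicComplex_d]
    exact s.sub_trace_sub_total_mem_rowsGE_zero x
  | succ n =>
    rw [nullHomotopicHom_f_succ, cyclicComplex_d, cyclicComplex_d]
    exact s.sub_trace_sub_total_mem_rowsGE_succ hx

theorem defect_pow_f_mem_rowsGE (m n : ℕ) (x : CyclicTotal k A n) :
    (s.defect ^ m).f n x ∈ rowsGE k A n m := by
  induction m with
  | zero => exact fun q hq => absurd hq (Nat.not_lt_zero _)
  | succ m ih =>
    rw [pow_succ']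
    exact s.defect_f_mem_rowsGE ih

theorem defect_pow_f_eq_zero (n : ℕ) : (s.defect ^ (n + 1)).f n = 0 :=
  ModuleCat.hom_ext <| LinearMap.ext fun x => funext fun q =>
    s.defect_pow_f_mem_rowsGE (n + 1) n x q q.isLt

theorem isNilpotent_homologyMap_defect (n : ℕ) :
    IsNilpotent (((HomologicalComplex.homologyFunctor (ModuleCat k) _ n).mapEnd _) s.defect) := by
  refine ⟨n + 1, ?_⟩
  rw [← map_pow]
  change HomologicalComplex.homologyMap (s.defect ^ (n + 1)) n = 0
  rw [← cancel_epi (HomologicalComplex.homologyπ _ n),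
    ← cancel_mono (HomologicalComplex.homologyι _ n)]
  simp [s.defect_pow_f_eq_zero n]

end ColumnHomotopy

/-- The generalized trace is unipotent on cyclic homology, the defect being nilpotent there. -/
theorem ColumnHomotopy.isIso_homologyMap_cyclicTrace (s : ColumnHomotopy F) (n : ℕ) :
    IsIso (HomologicalComplex.homologyMap (cyclicTrace F) n) := by
  have trace_eq : HomologicalComplex.homologyMap (cyclicTrace F) n =
      𝟙 _ - HomologicalComplex.homologyMap s.defect n := by
    rw [defect, HomologicalComplex.homologyMap_sub, HomologicalComplex.homologyMap_sub,
      homologyMap_nullHomotopicHom, HomologicalComplex.homologyMap_id, sub_zero, sub_sub_cancel]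
  rw [trace_eq, ← isUnit_iff_isIso]
  exact (s.isNilpotent_homologyMap_defect n).isUnit_one_sub

end RowFiltration

section CyclicConjugation

variable {A B C : Type u} [Ring A] [Ring B] [Ring C] [Algebra k A] [Algebra k B] [Algebra k C]
  {ι κ : Type} [Fintype ι] [Fintype κ]

theorem entry_conjHom_self [DecidableEq ι] {a b : ι → A} (h : ∑ i, a i * b i = 1) :
    (conjHom (Bimodule.self k A) h).entry = (conjAlgHom h).entry :=
  funext₂ fun i j => LinearMap.ext fun x => (mul_assoc (b i) x (a j)).symm

theorem exists_bar_homotopy_id_sub_traceMap (F : MatAlgHom k A A ι) :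
    ∃ s : ∀ n, Chains k A A n →ₗ[k] Chains k A A (n + 1),
      barBoundary k A A 0 ∘ₗ s 0 = LinearMap.id - traceMap F.entry F.entry 0 ∧
        ∀ n, barBoundary k A A (n + 1) ∘ₗ s (n + 1) =
          LinearMap.id - traceMap F.entry F.entry (n + 1) - s n ∘ₗ barBoundary k A A n := by
  classical
  refine ⟨fun n => barContraction k A n ∘ₗ (LinearMap.id - traceMap F.entry F.entry n), ?_,
    fun n => ?_⟩
  · rw [← LinearMap.comp_assoc, barBoundary_comp_barContraction_zero, LinearMap.id_comp]
  · have comm : barBoundary k A A n ∘ₗ (LinearMap.id - traceMap F.entry F.entry (n + 1)) =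
        (LinearMap.id - traceMap F.entry F.entry n) ∘ₗ barBoundary k A A n := by
      rw [LinearMap.comp_sub, LinearMap.sub_comp]
      exact congrArg _ (barBoundary_comp_traceMap (MatHom.self F) n)
    rw [← LinearMap.comp_assoc, barBoundary_comp_barContraction, LinearMap.sub_comp,
      LinearMap.comp_assoc, LinearMap.comp_assoc, comm]
    rfl

theorem nonempty_columnHomotopy_conj {a b : ι → A} (h : ∑ i, a i * b i = 1) :
    Nonempty (ColumnHomotopy (conjAlgHom (k := k) h)) := by
  classical
  obtain ⟨s, hs₀, hs⟩ := exists_homotopy_id_conj (Bimodule.self k A) h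
  obtain ⟨s', hs'₀, hs'⟩ := exists_bar_homotopy_id_sub_traceMap (conjAlgHom (k := k) h)
  rw [entry_conjHom_self] at hs₀ hs
  refine ⟨⟨fun p q => if Even p then s q else -s' q, fun p => ?_, fun p n => ?_⟩⟩
  · unfold vertical
    split_ifs
    · exact hs₀
    · rw [LinearMap.neg_comp, LinearMap.comp_neg, neg_neg, hs'₀]
  · unfold vertical
    split_ifs
    · exact hs n
    · rw [LinearMap.neg_comp, LinearMap.neg_comp, LinearMap.comp_neg, LinearMap.comp_neg, neg_neg,
        neg_neg, hs']

/-- A morphism of algebras, as a morphism to the matrices of size one. -/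
def MatAlgHom.ofUnique (f : A →ₙₐ[k] B) : MatAlgHom k A B Unit :=
  MatAlgHom.ofEntries (fun _ _ => f) fun _ _ x y => by simp

theorem traceMap_comp_ofUnique (f : A →ₙₐ[k] B) (G : MatAlgHom k B C ι) (n : ℕ) :
    traceMap G.entry G.entry n ∘ₗ
        traceMap (MatAlgHom.ofUnique f).entry (MatAlgHom.ofUnique f).entry n =
      traceMap (MatAlgHom.entry (G.comp f)) (MatAlgHom.entry (G.comp f)) n := by
  refine chains_hom_ext fun x => ?_
  rw [LinearMap.comp_apply, traceMap_of_unique, traceMap_pureTensor, traceMap_pureTensor]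
  rfl

theorem traceMap_ofUnique_comp {f : B →ₙₐ[k] C} {G : MatAlgHom k A B ι} {H : MatAlgHom k A C ι}
    (h : ∀ x i j, f (G x i j) = H x i j) (n : ℕ) :
    traceMap (MatAlgHom.ofUnique f).entry (MatAlgHom.ofUnique f).entry n ∘ₗ
        traceMap G.entry G.entry n =
      traceMap H.entry H.entry n := by
  refine chains_hom_ext fun x => ?_
  rw [LinearMap.comp_apply, traceMap_pureTensor, traceMap_pureTensor, map_sum]
  refine Finset.sum_congr rfl fun I _ => ?_
  rw [traceMap_of_unique]
  exact congrArg _ (Prod.ext (h _ _ _) (funext fun i => h _ _ _))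

theorem cyclicTrace_ofUnique_comp (f : A →ₙₐ[k] B) (G : MatAlgHom k B C ι) :
    cyclicTrace (MatAlgHom.ofUnique f) ≫ cyclicTrace G =
      cyclicTrace (G.comp f : MatAlgHom k A C ι) :=
  cyclicTrace_comp (traceMap_comp_ofUnique f G)

theorem cyclicTrace_conj_single [DecidableEq ι] (i₀ : ι) :
    cyclicTrace (conjAlgHom (sum_single_mul_single A i₀)) = 𝟙 (cyclicComplex k A) :=
  cyclicTrace_eq_id fun n => by
    simpa only [entry_conjHom_self] using traceMap_conj_single (Bimodule.self k A) i₀ n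

theorem cyclicTrace_conj_option_elim {a b : ι → A} (h : ∑ i, a i * b i = 1) :
    cyclicTrace (conjAlgHom (sum_option_elim h)) = cyclicTrace (conjAlgHom (k := k) h) := by
  classical
  refine cyclicTrace_congr fun n => ?_
  simpa only [entry_conjHom_self] using traceMap_conj_option_elim (Bimodule.self k A) h n

section MatrixTrace

variable [DecidableEq ι]

variable (k A ι) in
/-- The chain map of cyclic complexes given by the generalized trace of square matrices. -/
def matrixTrace : cyclicComplex k (Matrix ι ι A) ⟶ cyclicComplex k A :=
  cyclicTrace (NonUnitalAlgHom.id k (Matrix ι ι A) : MatAlgHom k (Matrix ι ι A) A ι)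

variable (k A) in
/-- The chain map of cyclic complexes induced by the inclusion `x ↦ x Eᵢᵢ` of algebras. -/
def cornerInclusion (i : ι) : cyclicComplex k A ⟶ cyclicComplex k (Matrix ι ι A) :=
  cyclicTrace (MatAlgHom.ofUnique (conjAlgHom (sum_single_mul_single A i)))

theorem cornerInclusion_comp_matrixTrace (i : ι) :
    cornerInclusion k A i ≫ matrixTrace k A ι = 𝟙 (cyclicComplex k A) :=
  (cyclicTrace_ofUnique_comp _ _).trans (cyclicTrace_conj_single i)

theorem conjAlgHom_single_apply (i : ι) (x : A) :
    conjAlgHom (k := k) (sum_single_mul_single A i) x = Matrix.single i i x := by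
  ext j l
  rw [conjAlgHom_apply]
  simp only [Pi.single_apply, Matrix.single_apply]
  grind

theorem sum_single_mul_single_matrix (i₀ : ι) :
    ∑ i, Matrix.single i i₀ (1 : A) * Matrix.single i₀ i 1 = 1 := by
  simp only [Matrix.single_mul_single_same, mul_one]
  exact Matrix.sum_single_one

theorem matrixTrace_comp_cornerInclusion (i : ι) :
    matrixTrace k A ι ≫ cornerInclusion k A i =
      cyclicTrace (conjAlgHom (sum_single_mul_single_matrix (A := A) i)) :=
  cyclicTrace_comp <| traceMap_ofUnique_comp fun X j l => by
    ext x y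
    rw [conjAlgHom_single_apply, conjAlgHom_apply, Matrix.single_mul_mul_single, one_mul, mul_one]
    rfl

/-- Both inclusions are sections of the trace of matrices, a monomorphism on homology. -/
theorem homologyMap_cornerInclusion_eq (i j : ι) (n : ℕ) :
    HomologicalComplex.homologyMap (cornerInclusion k A i) n =
      HomologicalComplex.homologyMap (cornerInclusion k A j) n := by
  obtain ⟨s⟩ := nonempty_columnHomotopy_conj (k := k) (sum_single_mul_single_matrix (A := A) i)
  have iso := s.isIso_homologyMap_cyclicTrace n
  rw [← matrixTrace_comp_cornerInclusion, HomologicalComplex.homologyMap_comp] at iso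
  have mono := mono_of_mono (HomologicalComplex.homologyMap (matrixTrace k A ι) n)
    (HomologicalComplex.homologyMap (cornerInclusion k A i) n)
  rw [← cancel_mono (HomologicalComplex.homologyMap (matrixTrace k A ι) n),
    ← HomologicalComplex.homologyMap_comp, ← HomologicalComplex.homologyMap_comp,
    cornerInclusion_comp_matrixTrace, cornerInclusion_comp_matrixTrace]

/-- The morphism `X ↦ V X W` of matrix algebras given by matrices with `W V = 1`. -/
def sandwich {V : Matrix κ ι A} {W : Matrix ι κ A} (h : W * V = 1) :
    Matrix ι ι A →ₙₐ[k] Matrix κ κ A where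
  toFun X := V * X * W
  map_smul' c X := by simp
  map_zero' := by simp
  map_add' X Y := by rw [Matrix.mul_add, Matrix.add_mul]
  map_mul' X Y := by
    rw [Matrix.mul_assoc (V * X), ← Matrix.mul_assoc W, ← Matrix.mul_assoc W, h, Matrix.one_mul,
      ← Matrix.mul_assoc, ← Matrix.mul_assoc]

theorem cornerInclusion_comp_sandwich {V : Matrix κ ι A} {W : Matrix ι κ A} (h : W * V = 1) (l : ι)
    (hl : ∑ i, W l i * V i l = 1) :
    cornerInclusion k A l ≫ cyclicTrace (sandwich h) = cyclicTrace (conjAlgHom hl) := by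
  rw [cornerInclusion, cyclicTrace_ofUnique_comp]
  refine congrArg cyclicTrace (NonUnitalAlgHom.ext fun x => Matrix.ext fun i j => ?_)
  change (V * conjAlgHom (k := k) (sum_single_mul_single A l) x * W) i j = V i l * x * W l j
  rw [conjAlgHom_single_apply]
  simp [Matrix.mul_apply, Matrix.single_apply, ite_and]

end MatrixTrace

theorem homologyMap_cyclicTrace_conjAlgHom {a b : ι → A} (h : ∑ i, a i * b i = 1) (n : ℕ) :
    HomologicalComplex.homologyMap (cyclicTrace (conjAlgHom h)) n =
      𝟙 ((cyclicComplex k A).homology n) := by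
  classical
  let a' (l : Bool) : Option ι → A := l.rec (Pi.single none 1) fun i => i.elim 0 a
  let b' (l : Bool) : Option ι → A := l.rec (Pi.single none 1) fun i => i.elim 0 b
  have hab : Matrix.of a' * (Matrix.of b').transpose = 1 := by
    ext l m
    rcases l <;> rcases m <;> simp [Matrix.mul_apply, Fintype.sum_option, a', b', h]
  have corner_true : cornerInclusion k A true ≫ cyclicTrace (sandwich hab) =
      cyclicTrace (conjAlgHom h) :=
    (cornerInclusion_comp_sandwich hab true (sum_option_elim h)).trans
      (cyclicTrace_conj_option_elim h)
  have corner_false : cornerInclusion k A false ≫ cyclicTrace (sandwich hab) = 𝟙 _ :=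
    (cornerInclusion_comp_sandwich hab false (sum_single_mul_single A none)).trans
      (cyclicTrace_conj_single none)
  rw [← corner_true, HomologicalComplex.homologyMap_comp, homologyMap_cornerInclusion_eq true false,
    ← HomologicalComplex.homologyMap_comp, corner_false, HomologicalComplex.homologyMap_id]

end CyclicConjugation

/-! ### Transfer along a Morita context -/

namespace Bimodule

variable {A B C : Type u} [Ring A] [Ring B] [Ring C] [Algebra k A] [Algebra k B] [Algebra k C]
  {X : Bimodule k A B} {Y : Bimodule k B C} {Z : Type*} [AddCommGroup Z] [Module k Z]

variable (X Y) in
/-- The universal balanced bilinear map `X × Y → X ⊗_B Y`. -/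
def tmulHom : X →ₗ[k] Y →ₗ[k] X.tensor Y :=
  (TensorProduct.mk k X Y).compr₂ (balancing X Y).mkQ

/-- The linear map on `X ⊗_B Y` given by a balanced bilinear map. -/
def tensorLift (β : X →ₗ[k] Y →ₗ[k] Z) (hβ : ∀ x (b : B) y, β (op b • x) y = β x (b • y)) :
    X.tensor Y →ₗ[k] Z :=
  (balancing X Y).liftQ (TensorProduct.lift β) <| by
    rw [balancing, Submodule.span_le]
    rintro _ ⟨x, b, y, rfl⟩
    simp [hβ]

theorem tensorLift_tmul (β : X →ₗ[k] Y →ₗ[k] Z)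
    (hβ : ∀ x (b : B) y, β (op b • x) y = β x (b • y)) (x : X) (y : Y) :
    tensorLift β hβ (tmul x y) = β x y :=
  (Submodule.liftQ_apply _ _ _).trans (TensorProduct.lift.tmul _ _)

@[elab_as_elim]
theorem tensor_induction {c : X.tensor Y → Prop} (z : X.tensor Y) (zero : c 0)
    (tmul : ∀ x y, c (tmul x y)) (add : ∀ z w, c z → c w → c (z + w)) : c z := by
  obtain ⟨z, rfl⟩ := Submodule.Quotient.mk_surjective (balancing X Y) z
  induction z with
  | zero => exact zero
  | tmul x y => exact tmul x y
  | add z w hz hw => exact add _ _ hz hw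

theorem exists_eq_sum_tmul (z : X.tensor Y) :
    ∃ (n : ℕ) (x : Fin n → X) (y : Fin n → Y), z = ∑ i, tmul (x i) (y i) := by
  induction z using tensor_induction with
  | zero => exact ⟨0, Fin.elim0, Fin.elim0, by simp⟩
  | tmul x y => exact ⟨1, fun _ => x, fun _ => y, by simp⟩
  | add z w hz hw =>
    obtain ⟨n, x, y, rfl⟩ := hz
    obtain ⟨m, x', y', rfl⟩ := hw
    exact ⟨n + m, Fin.append x x', Fin.append y y', by simp [Fin.sum_univ_add]⟩

end Bimodule

namespace MoritaContext

open Bimodule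

variable (𝓒 : MoritaContext.{u} k)

/-- The Morita context with the roles of the two algebras exchanged. -/
abbrev symm : MoritaContext.{u} k where
  R := 𝓒.S
  S := 𝓒.R
  P := 𝓒.Q
  Q := 𝓒.P
  φ := 𝓒.ψ
  ψ := 𝓒.φ
  φ_smul := 𝓒.ψ_smul
  ψ_smul := 𝓒.φ_smul

/-- The bilinear pairing `P × Q → S` underlying `φ`. -/
def pairS : 𝓒.P →ₗ[k] 𝓒.Q →ₗ[k] 𝓒.S :=
  (tmulHom 𝓒.P 𝓒.Q).compr₂ 𝓒.φ.toLinearEquiv.toLinearMap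

/-- The bilinear pairing `Q × P → R` underlying `ψ`. -/
def pairR : 𝓒.Q →ₗ[k] 𝓒.P →ₗ[k] 𝓒.R :=
  𝓒.symm.pairS

variable {𝓒}

section Pairings

variable (r : 𝓒.R) (s : 𝓒.S) (p p' : 𝓒.P) (q q' : 𝓒.Q)

theorem pairS_smul : 𝓒.pairS (s • p) q = s * 𝓒.pairS p q :=
  𝓒.φ.map_smul s (tmul p q)

theorem pairS_op_smul : 𝓒.pairS p (op s • q) = 𝓒.pairS p q * s :=
  𝓒.φ.map_op_smul s (tmul p q)

theorem pairS_balanced : 𝓒.pairS (op r • p) q = 𝓒.pairS p (r • q) :=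
  congrArg 𝓒.φ.toLinearEquiv (tmul_balanced p r q)

theorem pairS_smul_eq : 𝓒.pairS p q • p' = op (𝓒.pairR q p') • p :=
  𝓒.φ_smul p q p'

theorem pairR_smul : 𝓒.pairR (r • q) p = r * 𝓒.pairR q p :=
  pairS_smul (𝓒 := 𝓒.symm) r q p

theorem pairR_op_smul : 𝓒.pairR q (op r • p) = 𝓒.pairR q p * r :=
  pairS_op_smul (𝓒 := 𝓒.symm) r q p

theorem pairR_balanced : 𝓒.pairR (op s • q) p = 𝓒.pairR q (s • p) :=
  pairS_balanced (𝓒 := 𝓒.symm) s q p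

theorem pairR_smul_eq : 𝓒.pairR q p • q' = op (𝓒.pairS p q') • q :=
  pairS_smul_eq (𝓒 := 𝓒.symm) q q' p

end Pairings

variable (𝓒) in
/-- A decomposition `1 = ∑ ψ(qᵢ ⊗ pᵢ)` of the unit of `R`, from which the transfer maps are built.
A decomposition of the unit of `S` is encoded as one of the context `𝓒.symm`. -/
structure UnitDecomposition (ι : Type) [Fintype ι] where
  p : ι → 𝓒.P
  q : ι → 𝓒.Q
  sum_pairR : ∑ i, 𝓒.pairR (q i) (p i) = 1

variable (𝓒) in
theorem nonempty_unitDecomposition : Nonempty (Σ n : ℕ, 𝓒.UnitDecomposition (Fin n)) := by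
  obtain ⟨n, q, p, h⟩ := exists_eq_sum_tmul (𝓒.ψ.toLinearEquiv.symm (1 : 𝓒.R))
  refine ⟨n, p, q, ?_⟩
  rw [LinearEquiv.symm_apply_eq, map_sum] at h
  exact h.symm

variable {ι ι' κ : Type} [Fintype ι] [Fintype ι'] [Fintype κ]

namespace UnitDecomposition

variable (d : 𝓒.UnitDecomposition ι) (d' : 𝓒.symm.UnitDecomposition κ)

theorem sum_pairS_smul (p : 𝓒.P) : ∑ i, 𝓒.pairS p (d.q i) • d.p i = p := by
  simp only [pairS_smul_eq, ← Finset.sum_smul, ← Finset.op_sum, d.sum_pairR, op_one, one_smul]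

theorem sum_op_pairS_smul (q : 𝓒.Q) : ∑ i, op (𝓒.pairS (d.p i) q) • d.q i = q := by
  simp only [← pairR_smul_eq, ← Finset.sum_smul, d.sum_pairR, one_smul]

theorem sum_pairS_mul_pairS (p : 𝓒.P) (q : 𝓒.Q) :
    ∑ i, 𝓒.pairS p (d.q i) * 𝓒.pairS (d.p i) q = 𝓒.pairS p q := by
  simp only [← pairS_op_smul, ← map_sum, d.sum_op_pairS_smul]

/-- The morphism `r ↦ (φ(pᵢ r ⊗ qⱼ))` of algebras from `R` to matrices over `S`. -/
def transfer : MatAlgHom k 𝓒.R 𝓒.S ι :=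
  MatAlgHom.ofEntries
    (fun i j => 𝓒.pairS (d.p i) ∘ₗ (LinearMap.toSpanSingleton 𝓒.R 𝓒.Q (d.q j)).restrictScalars k)
    fun i j x y => by
      change 𝓒.pairS (d.p i) ((x * y) • d.q j) =
        ∑ l, 𝓒.pairS (d.p i) (x • d.q l) * 𝓒.pairS (d.p l) (y • d.q j)
      simp only [mul_smul, ← pairS_balanced x, d.sum_pairS_mul_pairS]

theorem transfer_entry_apply (i j : ι) (r : 𝓒.R) :
    d.transfer.entry i j r = 𝓒.pairS (d.p i) (r • d.q j) :=
  rfl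

variable (M : Bimodule k 𝓒.R 𝓒.R)

/-- The morphism `m ↦ (pᵢ ⊗ m ⊗ qⱼ)` of bimodules from `M` to matrices over `P ⊗_R M ⊗_R Q`. -/
def transferHom [DecidableEq ι] : MatHom M (𝓒.baseChange M) d.transfer :=
  MatHom.ofEntries _
    (fun i j => (tmulHom (𝓒.P.tensor M) 𝓒.Q).flip (d.q j) ∘ₗ tmulHom 𝓒.P M (d.p i))
    (fun i j x m => by
      let T := (tmulHom (𝓒.P.tensor M) 𝓒.Q).flip (d.q j) ∘ₗ (tmulHom 𝓒.P M).flip m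
      calc tmul (tmul (d.p i) (x • m)) (d.q j)
        _ = T (op x • d.p i) := congrArg (tmul · (d.q j)) (tmul_balanced (d.p i) x m).symm
        _ = ∑ l, T (𝓒.pairS (op x • d.p i) (d.q l) • d.p l) := by
          rw [← map_sum, d.sum_pairS_smul]
        _ = ∑ l, 𝓒.pairS (d.p i) (x • d.q l) • tmul (tmul (d.p l) m) (d.q j) := by
          simp only [pairS_balanced]
          rfl)
    (fun i j x m => by
      let T := tmulHom (𝓒.P.tensor M) 𝓒.Q (tmul (d.p i) m)
      calc tmul (tmul (d.p i) (op x • m)) (d.q j)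
        _ = T (x • d.q j) := tmul_balanced (tmul (d.p i) m) x (d.q j)
        _ = ∑ l, T (op (𝓒.pairS (d.p l) (x • d.q j)) • d.q l) := by
          rw [← map_sum, d.sum_op_pairS_smul]
        _ = ∑ l, op (𝓒.pairS (d.p l) (x • d.q j)) • tmul (tmul (d.p i) m) (d.q l) := rfl)

theorem transferHom_entry_apply [DecidableEq ι] (i j : ι) (m : M) :
    (d.transferHom M).entry i j m = tmul (tmul (d.p i) m) (d.q j) :=
  rfl

end UnitDecomposition

section Contraction

variable (M : Bimodule k 𝓒.R 𝓒.R)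

/-- The map `p ⊗ m ↦ ψ(q ⊗ p) m`. -/
def contractLeft (q : 𝓒.Q) : 𝓒.P.tensor M →ₗ[k] M :=
  tensorLift ((Algebra.lsmul k k M).toLinearMap ∘ₗ 𝓒.pairR q) fun p r m => by
    simp [pairR_op_smul]

theorem contractLeft_tmul (q : 𝓒.Q) (p : 𝓒.P) (m : M) :
    contractLeft M q (tmul p m) = 𝓒.pairR q p • m :=
  tensorLift_tmul _ _ _ _

theorem contractLeft_op_smul (q : 𝓒.Q) (r : 𝓒.R) (t : 𝓒.P.tensor M) :
    contractLeft M q (op r • t) = op r • contractLeft M q t := by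
  induction t using tensor_induction with
  | zero => rw [smul_zero, map_zero, smul_zero]
  | tmul p m => rw [op_smul_tmul, contractLeft_tmul, contractLeft_tmul, smul_comm]
  | add z w hz hw => rw [smul_add, map_add, hz, hw, map_add, smul_add]

/-- The map `p ⊗ m ⊗ q' ↦ ψ(q ⊗ p) m ψ(q' ⊗ p')`. -/
def contract (q : 𝓒.Q) (p' : 𝓒.P) : 𝓒.baseChange M →ₗ[k] M :=
  tensorLift (X := 𝓒.P.tensor M) (Y := 𝓒.Q)
    (((Algebra.lsmul k k M).toLinearMap ∘ₗ (opLinearEquiv k).toLinearMap ∘ₗ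
      𝓒.pairR.flip p').flip ∘ₗ contractLeft M q) fun t r q' => by
    simp [contractLeft_op_smul, pairR_smul]

variable {M}

theorem contract_tmul (q : 𝓒.Q) (p' p : 𝓒.P) (m : M) (q' : 𝓒.Q) :
    contract M q p' (tmul (tmul p m) q') = op (𝓒.pairR q' p') • 𝓒.pairR q p • m :=
  (tensorLift_tmul _ _ _ _).trans (by simp [contractLeft_tmul])

@[elab_as_elim]
theorem baseChange_induction {c : 𝓒.baseChange M → Prop} (z : 𝓒.baseChange M) (zero : c 0)
    (tmul : ∀ p m q, c (tmul (tmul p m) q)) (add : ∀ z w, c z → c w → c (z + w)) : c z := by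
  refine tensor_induction (c := c) z zero (fun t q => ?_) add
  induction t using tensor_induction with
  | zero => exact (congrArg c ((tmulHom (𝓒.P.tensor M) 𝓒.Q).map_zero₂ q)).mpr zero
  | tmul p m => exact tmul p m q
  | add t t' ht ht' =>
    exact (congrArg c ((tmulHom (𝓒.P.tensor M) 𝓒.Q).map_add₂ t t' q)).mpr (add _ _ ht ht')

theorem contract_smul (q : 𝓒.Q) (p' : 𝓒.P) (s : 𝓒.S) (z : 𝓒.baseChange M) :
    contract M q p' (s • z) = contract M (op s • q) p' z := by
  induction z using baseChange_induction with
  | zero => simp only [smul_zero, map_zero]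
  | add z w hz hw => simp only [smul_add, map_add, hz, hw]
  | tmul p m q' =>
    rw [contract_tmul, pairR_balanced]
    exact contract_tmul q p' (s • p) m q'

theorem contract_op_smul (q : 𝓒.Q) (p' : 𝓒.P) (s : 𝓒.S) (z : 𝓒.baseChange M) :
    contract M q p' (op s • z) = contract M q (s • p') z := by
  induction z using baseChange_induction with
  | zero => simp only [smul_zero, map_zero]
  | add z w hz hw => simp only [smul_add, map_add, hz, hw]
  | tmul p m q' =>
    rw [contract_tmul, ← pairR_balanced]
    exact contract_tmul q p' p m (op s • q')

end Contraction

namespace UnitDecomposition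

variable (d : 𝓒.UnitDecomposition ι) (d' : 𝓒.symm.UnitDecomposition κ) (M : Bimodule k 𝓒.R 𝓒.R)

theorem sum_pairR_mul_pairR (q : 𝓒.Q) (p : 𝓒.P) :
    ∑ i, 𝓒.pairR q (d'.q i) * 𝓒.pairR (d'.p i) p = 𝓒.pairR q p :=
  d'.sum_pairS_mul_pairS q p

variable {M} in
theorem sum_pairR_smul_contract (q : 𝓒.Q) (p' : 𝓒.P) (z : 𝓒.baseChange M) :
    ∑ i, 𝓒.pairR q (d'.q i) • contract M (d'.p i) p' z = contract M q p' z := by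
  induction z using baseChange_induction with
  | zero => simp only [map_zero, smul_zero, Finset.sum_const_zero]
  | add z w hz hw => simp only [map_add, smul_add, Finset.sum_add_distrib, hz, hw]
  | tmul p m q' =>
    simp only [contract_tmul, smul_comm _ (op _), smul_smul _ _ m, ← Finset.smul_sum,
      ← Finset.sum_smul, d'.sum_pairR_mul_pairR]

variable {M} in
theorem sum_op_pairR_smul_contract (q : 𝓒.Q) (p' : 𝓒.P) (z : 𝓒.baseChange M) :
    ∑ i, op (𝓒.pairR (d'.p i) p') • contract M q (d'.q i) z = contract M q p' z := by
  induction z using baseChange_induction with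
  | zero => simp only [map_zero, smul_zero, Finset.sum_const_zero]
  | add z w hz hw => simp only [map_add, smul_add, Finset.sum_add_distrib, hz, hw]
  | tmul p m q' =>
    simp only [contract_tmul, smul_smul (op _), ← op_mul, ← Finset.sum_smul, ← Finset.op_sum,
      d'.sum_pairR_mul_pairR]

/-- The morphism `s ↦ (ψ(qᵢ s ⊗ pⱼ))` of algebras from `S` to matrices over `R`. -/
def transferBack : MatAlgHom k 𝓒.S 𝓒.R κ :=
  d'.transfer

theorem transferBack_entry_apply (i j : κ) (s : 𝓒.S) :
    d'.transferBack.entry i j s = 𝓒.pairR (d'.p i) (s • d'.q j) :=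
  rfl

/-- The morphism `p ⊗ m ⊗ q ↦ (ψ(qᵢ ⊗ p) m ψ(q ⊗ pⱼ))` of bimodules from `P ⊗_R M ⊗_R Q` to
matrices over `M`. -/
def transferBackHom [DecidableEq κ] : MatHom (𝓒.baseChange M) M d'.transferBack :=
  MatHom.ofEntries _ (fun i j => contract M (d'.p i) (d'.q j))
    (fun i j s z => by
      simp only [transferBack_entry_apply, ← pairR_balanced, contract_smul,
        d'.sum_pairR_smul_contract])
    (fun i j s z => by
      simp only [transferBack_entry_apply, contract_op_smul, d'.sum_op_pairR_smul_contract])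

theorem transferBackHom_entry_apply [DecidableEq κ] (i j : κ) (p : 𝓒.P) (m : M) (q : 𝓒.Q) :
    (d'.transferBackHom M).entry i j (tmul (tmul p m) q) =
      op (𝓒.pairR q (d'.q j)) • 𝓒.pairR (d'.p i) p • m :=
  contract_tmul _ _ _ _ _

theorem sum_pairR_mul_pairR_eq_one :
    ∑ i : ι × κ, 𝓒.pairR (d.q i.1) (d'.q i.2) * 𝓒.pairR (d'.p i.2) (d.p i.1) = 1 := by
  simp only [Fintype.sum_prod_type, d'.sum_pairR_mul_pairR, d.sum_pairR]

theorem sum_pairS_mul_pairS_eq_one :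
    ∑ i : κ × ι, 𝓒.pairS (d'.q i.1) (d.q i.2) * 𝓒.pairS (d.p i.2) (d'.p i.1) = 1 :=
  d'.sum_pairR_mul_pairR_eq_one d

theorem transferBack_entry_comp_transfer_entry :
    (fun i j : ι × κ => d'.transferBack.entry i.2 j.2 ∘ₗ d.transfer.entry i.1 j.1) =
      (conjAlgHom (sum_pairR_mul_pairR_eq_one d d')).entry := by
  refine funext₂ fun i j => LinearMap.ext fun x => ?_
  change 𝓒.pairR (d'.p i.2) (𝓒.pairS (d.p i.1) (x • d.q j.1) • d'.q j.2) =
    𝓒.pairR (d'.p i.2) (d.p i.1) * x * 𝓒.pairR (d.q j.1) (d'.q j.2)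
  rw [pairS_smul_eq, pairR_op_smul, pairR_smul, mul_assoc]

theorem transfer_entry_comp_transferBack_entry :
    (fun i j : κ × ι => d.transfer.entry i.2 j.2 ∘ₗ d'.transferBack.entry i.1 j.1) =
      (conjAlgHom (sum_pairS_mul_pairS_eq_one d d')).entry :=
  d'.transferBack_entry_comp_transfer_entry d

section Hochschild

variable [DecidableEq ι] [DecidableEq κ]

theorem transferBackHom_entry_comp_transferHom_entry :
    (fun i j : ι × κ =>
        (d'.transferBackHom M).entry i.2 j.2 ∘ₗ (d.transferHom M).entry i.1 j.1) =
      (conjHom M (sum_pairR_mul_pairR_eq_one d d')).entry := by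
  refine funext₂ fun i j => LinearMap.ext fun m => ?_
  rw [LinearMap.comp_apply, transferHom_entry_apply, transferBackHom_entry_apply, ← smul_comm]
  rfl

theorem transferHom_entry_comp_transferBackHom_entry :
    (fun i j : κ × ι =>
        (d.transferHom M).entry i.2 j.2 ∘ₗ (d'.transferBackHom M).entry i.1 j.1) =
      (conjHom (𝓒.baseChange M) (sum_pairS_mul_pairS_eq_one d d')).entry := by
  refine funext₂ fun i j => LinearMap.ext fun z => ?_
  rw [LinearMap.comp_apply]
  induction z using baseChange_induction with
  | zero => simp only [map_zero]
  | add z w hz hw => simp only [map_add, hz, hw]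
  | tmul p m q =>
    change (d.transferHom M).entry i.2 j.2 ((d'.transferBackHom M).entry i.1 j.1 _) =
      tmul (tmul (𝓒.pairS (d.p i.2) (d'.p i.1) • p) m) (op (𝓒.pairS (d'.q j.1) (d.q j.2)) • q)
    rw [transferBackHom_entry_apply, transferHom_entry_apply, pairS_smul_eq, ← pairR_smul_eq,
      ← tmul_balanced, op_smul_tmul, tmul_balanced (d.p i.2), smul_comm (𝓒.pairR (d'.p i.1) p)]

theorem hochschildTrace_transferHom_comp :
    hochschildTrace (d.transferHom M) ≫ hochschildTrace (d'.transferBackHom M) =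
      hochschildTrace (conjHom M (sum_pairR_mul_pairR_eq_one d d')) :=
  hochschildTrace_comp fun n => by
    rw [traceMap_comp, transferBack_entry_comp_transfer_entry,
      transferBackHom_entry_comp_transferHom_entry]

theorem hochschildTrace_transferBackHom_comp :
    hochschildTrace (d'.transferBackHom M) ≫ hochschildTrace (d.transferHom M) =
      hochschildTrace (conjHom (𝓒.baseChange M) (sum_pairS_mul_pairS_eq_one d d')) :=
  hochschildTrace_comp fun n => by
    rw [traceMap_comp, transfer_entry_comp_transferBack_entry,
      transferHom_entry_comp_transferBackHom_entry]

/-- The isomorphism `H_n(R, M) ≅ H_n(S, P ⊗_R M ⊗_R Q)` given by decompositions of the units of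
`R` and `S`. -/
def hochschildIso (n : ℕ) : hochschildHomology n M ≅ hochschildHomology n (𝓒.baseChange M) where
  hom := HomologicalComplex.homologyMap (hochschildTrace (d.transferHom M)) n
  inv := HomologicalComplex.homologyMap (hochschildTrace (d'.transferBackHom M)) n
  hom_inv_id := (HomologicalComplex.homologyMap_comp _ _ n).symm.trans <| by
    rw [hochschildTrace_transferHom_comp]
    exact homologyMap_hochschildTrace_conjHom _ M n
  inv_hom_id := (HomologicalComplex.homologyMap_comp _ _ n).symm.trans <| by
    rw [hochschildTrace_transferBackHom_comp]
    exact homologyMap_hochschildTrace_conjHom _ (𝓒.baseChange M) n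

theorem homologyMap_hochschildTrace_transferHom_eq [DecidableEq ι']
    (d₁ : 𝓒.UnitDecomposition ι') (n : ℕ) :
    HomologicalComplex.homologyMap (hochschildTrace (d.transferHom M)) n =
      HomologicalComplex.homologyMap (hochschildTrace (d₁.transferHom M)) n := by
  obtain ⟨m, d'⟩ := 𝓒.symm.nonempty_unitDecomposition
  exact congrArg Iso.hom (Iso.ext_inv (α := d.hochschildIso d' M n) (β := d₁.hochschildIso d' M n)
    rfl)

end Hochschild

theorem cyclicTrace_transfer_comp :
    cyclicTrace d.transfer ≫ cyclicTrace d'.transferBack =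
      cyclicTrace (conjAlgHom (sum_pairR_mul_pairR_eq_one d d')) :=
  cyclicTrace_comp fun n => by
    rw [traceMap_comp, transferBack_entry_comp_transfer_entry]

theorem cyclicTrace_transferBack_comp :
    cyclicTrace d'.transferBack ≫ cyclicTrace d.transfer =
      cyclicTrace (conjAlgHom (sum_pairS_mul_pairS_eq_one d d')) :=
  d'.cyclicTrace_transfer_comp d

/-- The isomorphism `HC_n(R) ≅ HC_n(S)` given by decompositions of the units of `R` and `S`. -/
def cyclicIso (n : ℕ) : cyclicHomology k 𝓒.R n ≅ cyclicHomology k 𝓒.S n where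
  hom := HomologicalComplex.homologyMap (cyclicTrace d.transfer) n
  inv := HomologicalComplex.homologyMap (cyclicTrace d'.transferBack) n
  hom_inv_id := (HomologicalComplex.homologyMap_comp _ _ n).symm.trans <| by
    rw [cyclicTrace_transfer_comp]
    exact homologyMap_cyclicTrace_conjAlgHom _ n
  inv_hom_id := (HomologicalComplex.homologyMap_comp _ _ n).symm.trans <| by
    rw [cyclicTrace_transferBack_comp]
    exact homologyMap_cyclicTrace_conjAlgHom _ n

theorem homologyMap_cyclicTrace_transfer_eq (d₁ : 𝓒.UnitDecomposition ι') (n : ℕ) :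
    HomologicalComplex.homologyMap (cyclicTrace d.transfer) n =
      HomologicalComplex.homologyMap (cyclicTrace d₁.transfer) n := by
  obtain ⟨m, d'⟩ := 𝓒.symm.nonempty_unitDecomposition
  exact congrArg Iso.hom (Iso.ext_inv (α := d.cyclicIso d' n) (β := d₁.cyclicIso d' n) rfl)

end UnitDecomposition

section Naturality

variable {𝓓 : MoritaContext.{u} k} (F : Hom 𝓒 𝓓)

theorem Hom.map_pairS (p : 𝓒.P) (q : 𝓒.Q) :
    𝓓.pairS (F.onP.toLinearMap p) (F.onQ.toLinearMap q) = F.onS (𝓒.pairS p q) :=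
  F.map_φ (tmul p q)

theorem Hom.map_pairR (q : 𝓒.Q) (p : 𝓒.P) :
    𝓓.pairR (F.onQ.toLinearMap q) (F.onP.toLinearMap p) = F.onR (𝓒.pairR q p) :=
  F.map_ψ (tmul q p)

namespace UnitDecomposition

variable (d : 𝓒.UnitDecomposition ι)

/-- The image of a decomposition of the unit under a morphism of Morita contexts. -/
def map : 𝓓.UnitDecomposition ι where
  p i := F.onP.toLinearMap (d.p i)
  q i := F.onQ.toLinearMap (d.q i)
  sum_pairR := by simp only [F.map_pairR, ← map_sum, d.sum_pairR, map_one]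

theorem onS_transfer_entry (i j : ι) (r : 𝓒.R) :
    F.onS (d.transfer.entry i j r) = (d.map F).transfer.entry i j (F.onR r) := by
  rw [transfer_entry_apply, transfer_entry_apply, ← F.map_pairS, F.onQ.map_smul]
  rfl

theorem hochschildTrace_transferHom_naturality [DecidableEq ι] {M : Bimodule k 𝓒.R 𝓒.R}
    {M' : Bimodule k 𝓓.R 𝓓.R} (μ : HomOver F.onR F.onR M M') :
    hochschildTrace (d.transferHom M) ≫ hochschildComplexMap (F.baseChange μ) =
      hochschildComplexMap μ ≫ hochschildTrace ((d.map F).transferHom M') :=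
  HomologicalComplex.hom_ext _ _ fun n => ModuleCat.hom_ext <|
    chainsMap_comp_traceMap F.onR F.onS μ.toLinearMap (F.baseChange μ).toLinearMap
      (d.onS_transfer_entry F) (fun _ _ _ => rfl) n

theorem cyclicTrace_transfer_naturality :
    cyclicTrace d.transfer ≫ cyclicComplexMap F.onS =
      cyclicComplexMap F.onR ≫ cyclicTrace (d.map F).transfer :=
  HomologicalComplex.hom_ext _ _ fun _ => ModuleCat.hom_ext <| LinearMap.ext fun x =>
    funext fun q => LinearMap.congr_fun
      (chainsMap_comp_traceMap F.onR F.onS F.onR.toLinearMap F.onS.toLinearMap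
        (d.onS_transfer_entry F) (d.onS_transfer_entry F) q) (x q)

theorem homologyMap_transferHom_naturality [DecidableEq ι] [DecidableEq κ]
    (d' : 𝓓.UnitDecomposition κ) {M : Bimodule k 𝓒.R 𝓒.R} {M' : Bimodule k 𝓓.R 𝓓.R}
    (μ : HomOver F.onR F.onR M M') (n : ℕ) :
    HomologicalComplex.homologyMap (hochschildTrace (d.transferHom M)) n ≫
        HomologicalComplex.homologyMap (hochschildComplexMap (F.baseChange μ)) n =
      HomologicalComplex.homologyMap (hochschildComplexMap μ) n ≫
        HomologicalComplex.homologyMap (hochschildTrace (d'.transferHom M')) n := by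
  rw [← HomologicalComplex.homologyMap_comp, hochschildTrace_transferHom_naturality,
    HomologicalComplex.homologyMap_comp,
    homologyMap_hochschildTrace_transferHom_eq (d.map F) M' d']

theorem homologyMap_transfer_naturality (d' : 𝓓.UnitDecomposition κ) (n : ℕ) :
    HomologicalComplex.homologyMap (cyclicTrace d.transfer) n ≫
        HomologicalComplex.homologyMap (cyclicComplexMap F.onS) n =
      HomologicalComplex.homologyMap (cyclicComplexMap F.onR) n ≫
        HomologicalComplex.homologyMap (cyclicTrace d'.transfer) n := by
  rw [← HomologicalComplex.homologyMap_comp, cyclicTrace_transfer_naturality,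
    HomologicalComplex.homologyMap_comp, homologyMap_cyclicTrace_transfer_eq (d.map F) d']

end UnitDecomposition

end Naturality

end MoritaContext

end

end MoritaInvariance

open MoritaInvariance

theorem corollary5p1 (k : Type v) [CommRing k] :
    (∃ e : ∀ (n : ℕ) (𝓒 : MoritaContext.{u} k) (M : Bimodule k 𝓒.R 𝓒.R),
        hochschildHomology n M ≅ hochschildHomology n (𝓒.baseChange M),
      ∀ (n : ℕ) (𝓒 𝓓 : MoritaContext.{u} k) (F : 𝓒.Hom 𝓓) (M : Bimodule k 𝓒.R 𝓒.R)
        (M' : Bimodule k 𝓓.R 𝓓.R) (μ : Bimodule.HomOver F.onR F.onR M M'),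
        (e n 𝓒 M).hom ≫ hochschildHomologyMap n (F.baseChange μ) =
          hochschildHomologyMap n μ ≫ (e n 𝓓 M').hom) ∧
    (∃ e : ∀ (n : ℕ) (𝓒 : MoritaContext.{u} k), cyclicHomology k 𝓒.R n ≅ cyclicHomology k 𝓒.S n,
      ∀ (n : ℕ) (𝓒 𝓓 : MoritaContext.{u} k) (F : 𝓒.Hom 𝓓),
        (e n 𝓒).hom ≫ cyclicHomologyMap F.onS n = cyclicHomologyMap F.onR n ≫ (e n 𝓓).hom) := by
  let d (𝓒 : MoritaContext.{u} k) := (Classical.choice 𝓒.nonempty_unitDecomposition).2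
  exact ⟨⟨fun n 𝓒 M => (d 𝓒).hochschildIso (d 𝓒.symm) M n,
      fun n 𝓒 𝓓 F _ _ μ => (d 𝓒).homologyMap_transferHom_naturality F (d 𝓓) μ n⟩,
    ⟨fun n 𝓒 => (d 𝓒).cyclicIso (d 𝓒.symm) n,
      fun n 𝓒 𝓓 F => (d 𝓒).homologyMap_transfer_naturality F (d 𝓓) n⟩⟩
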